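/- Let $\epsilon>0$ and $L_f>0$. **Problems and stationarity.** Consider problems of the form $$\min_{x\in\mathbb R^d} F_0(x):=f_0(x)+g(x)\quad\text{s.t. } Ax+b=0,\qquad g(x)=\bar g(\bar Ax+\bar b). \tag{P}$$ A point $x^*$ is an $\epsilon$-stationary point of (P) if for some vector $\gamma$ both $\operatorname{dist}\big(0,\nabla f_0(x^*)+A^\top\gamma+\partial g(x^*)\big)\le\epsilon$ and $\|Ax^*+b\|\le\epsilon$. A point $x$ is $\omega$-close to $x^*$ if $\|x-x^*\|\le\omega$. For a nonzero matrix $B$, let $\kappa(B)=\sqrt{\lambda_{\max}(BB^\top)/\lambda_{\min}(BB^\top)}$, where $\lambda_{\max}$ is the largest and $\lambda_{\min}$ the smallest positive eigenvalue, and let $[\bar A;A]$ be $\bar A$ stacked on top of $A$. **Splitting oracle model.** A sequence $(x^{(t)},y^{(t)})_{t\ge0}$ is generated in the splitting oracle model if for all $t\ge1$ $$x^{(t)}\in\operatorname{span}\Big(\{A^\top b,\bar A^\top\bar b\}\cup\bigcup_{s<t}\{x^{(s)},\nabla f_0(x^{(s)}),A^\top Ax^{(s)},\bar A^\top\bar Ax^{(s)},\bar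 A^\top y^{(s)}\}\Big),$$ and $y^{(t)}\in\operatorname{span}\{\xi^{(t)},\zeta^{(t)}\}$ for some $$\xi^{(t)}\in\operatorname{span}\Big(\{\bar b\}\cup\bigcup_{s<t}\{y^{(s)},\bar A\bar A^\top y^{(s)},\bar Ax^{(s)}\}\Big)$$ and some $\zeta^{(t)}=\operatorname{prox}_{\eta\bar g}(\xi^{(t)})=\arg\min_z\{\bar g(z)+\frac1{2\eta}\|z-\xi^{(t)}\|^2\}$ with $\eta>0$. Each iteration calls the oracle once, so that $x^{(t)}$ is obtained with $t$ oracles. **Instance $\mathcal P$.** Let $m_1\ge2$ and $m_2\ge1$ be integers with $m_1m_2$ even, let $\bar d\ge5$ be odd, and put $m=3m_1m_2$, $d=m\bar d$. Write $x=(x_1,\dots,x_m)\in\mathbb R^d$ with blocks $x_i\in\mathbb R^{\bar d}$. Let $J_m\in\mathbb R^{(m-1)\times m}$ have $i$-th row $e_{i+1}^\top-e_i^\top$, let $\mathcal M=\{im_1: i=1,\dots,3m_2-1\}$, and let $\bar A=mL_f\,J_{\mathcal M}\otimes I_{\bar d}$ and $A=mL_f\,J_{\mathcal M^C}\otimes I_{\bar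 d}$, where $J_{\mathcal M}$ and $J_{\mathcal M^C}$ consist of the rows of $J_m$ with index in $\mathcal M$ and not in $\mathcal M$; let $b=0$ and $\bar b=0$. Let $\bar g(y)=\frac{\beta}{mL_f}\|y\|_1$ with $\beta>(50\pi+1+\|A\|)\sqrt m\,\epsilon$, where $\|A\|$ is the spectral norm. Let $\Psi(u)=0$ for $u\le0$ and $\Psi(u)=1-e^{-u^2}$ for $u>0$, and $\Phi(v)=4\arctan v+2\pi$. For $z\in\mathbb R^{\bar d}$ let $\varphi(z,1)=-\Psi(1)\Phi(z_1)$ and $\varphi(z,j)=\Psi(-z_{j-1})\Phi(-z_j)-\Psi(z_{j-1})\Phi(z_j)$ for $2\le j\le\bar d$. Let $$h_i(z)=\begin{cases}\varphi(z,1)+3\sum_{j=1}^{\lfloor\bar d/2\rfloor}\varphi(z,2j),&1\le i\le\frac m3,\\ \varphi(z,1),&\frac m3<i\le\frac{2m}3,\\ \varphi(z,1)+3\sum_{j=1}^{\lfloor\bar d/2\rfloor}\varphi(z,2j+1),&\frac{2m}3<i\le m,\end{cases}$$ and let $f_0(x)=\sum_{i=1}^m\frac{300\pi\epsilon^2}{mL_f}\,h_i\!\left(\frac{\sqrt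 m\,L_f\,x_i}{150\pi\epsilon}\right)$. **Claim.** Every such instance $\mathcal P$ is a problem (P) in which $f_0$ is differentiable, $\nabla f_0$ is $L_f$-Lipschitz continuous, $\inf F_0>-\infty$, and $\bar g$ and $g$ are proper, lower semicontinuous and convex. Moreover, for every $\omega\in[0,\frac{150\pi\epsilon}{L_f})$ and every sequence $(x^{(t)},y^{(t)})_{t\ge0}$ generated in the splitting oracle model for $\mathcal P$ from $x^{(0)}=0$, $y^{(0)}=0$, if $x^{(t)}$ is $\omega$-close to an $\epsilon$-stationary point of $\mathcal P$, then $$t\ \ge\ \left\lceil\frac{\kappa([\bar A;A])\,L_f\,\Delta_{F_0}}{18000\pi^2}\,\epsilon^{-2}\right\rceil,\qquad \Delta_{F_0}=F_0(x^{(0)})-\inf_xF_0(x).$$ -/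

import Mathlib

noncomputable section

/-! ### Composite problems with affine constraints -/

/-- The data of the problem `min f₀(x) + g(x)  s.t.  A x + b = 0`, where `g(x) = ḡ(Ā x + b̄)` and
`ḡ` takes values in the extended reals. The coordinates of `x`, of `A x + b` and of `Ā x + b̄` are
indexed by `ι`, `κ` and `κ'`. -/
structure CompositeProblem (ι κ κ' : Type) where
  f0 : EuclideanSpace ℝ ι → ℝ
  A : Matrix κ ι ℝ
  b : EuclideanSpace ℝ κ
  Abar : Matrix κ' ι ℝ
  bbar : EuclideanSpace ℝ κ'
  gbar : EuclideanSpace ℝ κ' → EReal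

/-- Matrix times vector, on Euclidean spaces. -/
def mulVecE {ι κ : Type} [Fintype ι] (B : Matrix κ ι ℝ) (x : EuclideanSpace ℝ ι) :
    EuclideanSpace ℝ κ :=
  WithLp.toLp 2 (B.mulVec x.ofLp)

/-- The spectral norm of a matrix (operator norm between Euclidean spaces). -/
def spectralNorm2 {ι κ : Type} [Fintype ι] [DecidableEq ι] [Fintype κ] (B : Matrix κ ι ℝ) : ℝ :=
  ‖(Matrix.toEuclideanLin B).toContinuousLinearMap‖

/-- The condition number `√(λmax(B Bᵀ) / λmin(B Bᵀ))`, where `λmax` is the largest and `λmin` the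
smallest *positive* eigenvalue (for `B ≠ 0`). -/
def condNumber {ι κ : Type} [Fintype ι] [Fintype κ] [DecidableEq κ] (B : Matrix κ ι ℝ) : ℝ :=
  Real.sqrt (sSup (spectrum ℝ (B * B.transpose)) /
    sInf {μ : ℝ | μ ∈ spectrum ℝ (B * B.transpose) ∧ 0 < μ})

/-- `h` is proper, lower semicontinuous and convex (convexity: the epigraph is convex). -/
def ProperLscConvex {E : Type*} [AddCommGroup E] [Module ℝ E] [TopologicalSpace E]
    (h : E → EReal) : Prop :=
  ((∀ x, h x ≠ ⊥) ∧ ∃ x, h x ≠ ⊤) ∧ LowerSemicontinuous h ∧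
    Convex ℝ {p : E × ℝ | h p.1 ≤ (p.2 : EReal)}

/-- The subdifferential of an extended-valued convex function. -/
def subdiff {E : Type*} [NormedAddCommGroup E] [InnerProductSpace ℝ E]
    (h : E → EReal) (x : E) : Set E :=
  {ξ | h x ≠ ⊤ ∧ ∀ z, h x + ((inner ℝ ξ (z - x) : ℝ) : EReal) ≤ h z}

/-- `ζ = prox_{η h}(ξ)`: `ζ` minimizes `z ↦ h z + ‖z - ξ‖² / (2 η)`. -/
def IsProx {E : Type*} [NormedAddCommGroup E] (h : E → EReal) (η : ℝ) (ξ ζ : E) : Prop :=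
  ∀ z, h ζ + ((1 / (2 * η) * ‖ζ - ξ‖ ^ 2 : ℝ) : EReal) ≤
    h z + ((1 / (2 * η) * ‖z - ξ‖ ^ 2 : ℝ) : EReal)

namespace CompositeProblem

variable {ι κ κ' : Type} [Fintype ι] [Fintype κ] [Fintype κ']

/-- The regularizer `g(x) = ḡ(Ā x + b̄)`. -/
def g (P : CompositeProblem ι κ κ') (x : EuclideanSpace ℝ ι) : EReal :=
  P.gbar (mulVecE P.Abar x + P.bbar)

/-- The objective `F₀ = f₀ + g`. -/
def F0 (P : CompositeProblem ι κ κ') (x : EuclideanSpace ℝ ι) : EReal :=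
  (P.f0 x : EReal) + P.g x

/-- The standing assumptions on the problem: `f₀` is differentiable with `L`-Lipschitz gradient,
`F₀` is bounded below, and `ḡ` and `g` are proper, lower semicontinuous and convex. -/
def StandingAssumption (P : CompositeProblem ι κ κ') (L : ℝ) : Prop :=
  Differentiable ℝ P.f0 ∧
  (∀ x x' : EuclideanSpace ℝ ι, ‖gradient P.f0 x - gradient P.f0 x'‖ ≤ L * ‖x - x'‖) ∧
  ⊥ < (⨅ x, P.F0 x) ∧
  ProperLscConvex P.gbar ∧ ProperLscConvex P.g

/-- `x` is an `ε`-stationary point: for some multiplier `γ`,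
`dist(0, ∇f₀(x) + Aᵀ γ + ∂g(x)) ≤ ε` and `‖A x + b‖ ≤ ε` (the distance to `∅` is infinite). -/
def IsStationary (P : CompositeProblem ι κ κ') (ε : ℝ) (x : EuclideanSpace ℝ ι) : Prop :=
  ∃ γ : EuclideanSpace ℝ κ,
    Metric.infEDist 0
      ((fun ξ => gradient P.f0 x + mulVecE P.A.transpose γ + ξ) '' subdiff P.g x)
        ≤ ENNReal.ofReal ε ∧
    ‖mulVecE P.A x + P.b‖ ≤ ε

/-- The set whose span contains the iterate `x⁽ᵗ⁾`. -/
def xGenerators (P : CompositeProblem ι κ κ') (x : ℕ → EuclideanSpace ℝ ι)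
    (y : ℕ → EuclideanSpace ℝ κ') (t : ℕ) : Set (EuclideanSpace ℝ ι) :=
  {mulVecE P.A.transpose P.b, mulVecE P.Abar.transpose P.bbar} ∪
    ⋃ s < t, {x s, gradient P.f0 (x s), mulVecE P.A.transpose (mulVecE P.A (x s)),
      mulVecE P.Abar.transpose (mulVecE P.Abar (x s)), mulVecE P.Abar.transpose (y s)}

/-- The set whose span contains the prox-centre `ξ⁽ᵗ⁾`. -/
def ξGenerators (P : CompositeProblem ι κ κ') (x : ℕ → EuclideanSpace ℝ ι)
    (y : ℕ → EuclideanSpace ℝ κ') (t : ℕ) : Set (EuclideanSpace ℝ κ') :=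
  {P.bbar} ∪
    ⋃ s < t, {y s, mulVecE P.Abar (mulVecE P.Abar.transpose (y s)), mulVecE P.Abar (x s)}

/-- The linear-span assumption of the splitting oracle model: the `t`-th iterate is produced from
the previous ones by one call of the oracle, which offers `∇f₀`, products with `A`, `Ā` and
their transposes, and the proximal mapping of `ḡ`. -/
def SplittingSpan (P : CompositeProblem ι κ κ') (x : ℕ → EuclideanSpace ℝ ι)
    (y : ℕ → EuclideanSpace ℝ κ') : Prop :=
  ∀ t, 1 ≤ t →
    x t ∈ Submodule.span ℝ (P.xGenerators x y t) ∧
    ∃ ξ ∈ Submodule.span ℝ (P.ξGenerators x y t), ∃ η : ℝ, 0 < η ∧ ∃ ζ,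
      IsProx P.gbar η ξ ζ ∧ y t ∈ Submodule.span ℝ {ξ, ζ}

/-- The joint condition number `κ([Ā; A])` of the two matrices stacked by rows. -/
def jointCond [DecidableEq κ] [DecidableEq κ'] (P : CompositeProblem ι κ κ') : ℝ :=
  condNumber (Matrix.fromRows P.Abar P.A)

/-- The initial gap `Δ_{F₀} = F₀(x) - inf F₀`. -/
def gap (P : CompositeProblem ι κ κ') (x : EuclideanSpace ℝ ι) : ℝ :=
  (P.F0 x - ⨅ z, P.F0 z).toReal

end CompositeProblem

/-! ### The instance `𝒫`

The vector `x ∈ ℝ^{m d̄}` with blocks `x₁, …, x_m ∈ ℝ^{d̄}`, `m = 3 m₁ m₂`, is indexed by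
`Fin (3 * m₁ * m₂) × Fin dbar`. -/

namespace HardInstance

/-- The bidiagonal `(p - 1) × p` difference matrix with rows `(…, -1, 1, …)`. -/
def J (p : ℕ) : Matrix (Fin (p - 1)) (Fin p) ℝ := fun i k =>
  if (k : ℕ) = (i : ℕ) then -1 else if (k : ℕ) = (i : ℕ) + 1 then 1 else 0

/-- The row set `𝓜 = {k m₁ | k = 1, …, 3 m₂ - 1}`; rows are numbered from 1, so the row with
index `i : Fin (m - 1)` has number `i + 1`. -/
def rowSet (m₁ m₂ : ℕ) : Finset (Fin (3 * m₁ * m₂ - 1)) :=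
  Finset.univ.filter fun i => (i : ℕ) + 1 ∈ (Finset.Icc 1 (3 * m₂ - 1)).image fun k => k * m₁

/-- `m L_f · J_S ⊗ I_{d̄}`, where `J_S` consists of the rows of `J_m` in `S`. -/
def blockMatrix (Lf : ℝ) (m₁ m₂ dbar : ℕ) (S : Finset (Fin (3 * m₁ * m₂ - 1))) :
    Matrix (S × Fin dbar) (Fin (3 * m₁ * m₂) × Fin dbar) ℝ :=
  (((3 * m₁ * m₂ : ℕ) : ℝ) * Lf) •
    Matrix.kroneckerMap (fun a c => a * c)
      ((J (3 * m₁ * m₂)).submatrix (fun i : S => (i : Fin (3 * m₁ * m₂ - 1))) id)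
      (1 : Matrix (Fin dbar) (Fin dbar) ℝ)

/-- `Ā`, built from the rows in `𝓜`. -/
def Abar (Lf : ℝ) (m₁ m₂ dbar : ℕ) :
    Matrix (rowSet m₁ m₂ × Fin dbar) (Fin (3 * m₁ * m₂) × Fin dbar) ℝ :=
  blockMatrix Lf m₁ m₂ dbar (rowSet m₁ m₂)

/-- `A`, built from the rows not in `𝓜`. -/
def A (Lf : ℝ) (m₁ m₂ dbar : ℕ) :
    Matrix (((rowSet m₁ m₂)ᶜ : Finset _) × Fin dbar) (Fin (3 * m₁ * m₂) × Fin dbar) ℝ :=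
  blockMatrix Lf m₁ m₂ dbar (rowSet m₁ m₂)ᶜ

def Psi (u : ℝ) : ℝ := if u ≤ 0 then 0 else 1 - Real.exp (-u ^ 2)

def Phi (v : ℝ) : ℝ := 4 * Real.arctan v + 2 * Real.pi

/-- The coordinate `[z]_j`, numbered from 1 (only `1 ≤ j ≤ d̄` is used). -/
def coord {dbar : ℕ} (z : Fin dbar → ℝ) (j : ℕ) : ℝ :=
  if h : 1 ≤ j ∧ j ≤ dbar then z ⟨j - 1, by omega⟩ else 0

def phi {dbar : ℕ} (z : Fin dbar → ℝ) (j : ℕ) : ℝ :=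
  if j = 1 then -Psi 1 * Phi (coord z 1)
  else Psi (-coord z (j - 1)) * Phi (-coord z j) - Psi (coord z (j - 1)) * Phi (coord z j)

/-- `h_{i+1}`; blocks are numbered from 1 in the mathematics and from 0 in `Fin m`, and
`m / 3 = m₁ m₂`. -/
def h {m₁ m₂ dbar : ℕ} (i : Fin (3 * m₁ * m₂)) (z : Fin dbar → ℝ) : ℝ :=
  if (i : ℕ) < m₁ * m₂ then
    phi z 1 + 3 * ∑ j ∈ Finset.Icc 1 (dbar / 2), phi z (2 * j)
  else if (i : ℕ) < 2 * (m₁ * m₂) then phi z 1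
  else phi z 1 + 3 * ∑ j ∈ Finset.Icc 1 (dbar / 2), phi z (2 * j + 1)

/-- `f_{i+1}(z) = (300 π ε² / (m L_f)) h_{i+1}(√m L_f z / (150 π ε))`. -/
def f (ε Lf : ℝ) {m₁ m₂ dbar : ℕ} (i : Fin (3 * m₁ * m₂)) (z : Fin dbar → ℝ) : ℝ :=
  300 * Real.pi * ε ^ 2 / (((3 * m₁ * m₂ : ℕ) : ℝ) * Lf) *
    h i ((Real.sqrt ((3 * m₁ * m₂ : ℕ) : ℝ) * Lf / (150 * Real.pi * ε)) • z)

/-- `f₀(x) = ∑ᵢ fᵢ(xᵢ)`. -/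
def f0 (ε Lf : ℝ) (m₁ m₂ dbar : ℕ) (x : EuclideanSpace ℝ (Fin (3 * m₁ * m₂) × Fin dbar)) : ℝ :=
  ∑ i, f ε Lf i (fun j => x (i, j))

/-- `ḡ(y) = (β / (m L_f)) ‖y‖₁`. -/
def gbar (Lf β : ℝ) (m₁ m₂ dbar : ℕ) (y : EuclideanSpace ℝ (rowSet m₁ m₂ × Fin dbar)) : EReal :=
  ((β / (((3 * m₁ * m₂ : ℕ) : ℝ) * Lf) * ∑ p, |y p| : ℝ) : EReal)

end HardInstance

/-- The instance `𝒫`. -/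
def hardInstance (ε Lf β : ℝ) (m₁ m₂ dbar : ℕ) :
    CompositeProblem (Fin (3 * m₁ * m₂) × Fin dbar)
      (((HardInstance.rowSet m₁ m₂)ᶜ : Finset _) × Fin dbar)
      (HardInstance.rowSet m₁ m₂ × Fin dbar) where
  f0 := HardInstance.f0 ε Lf m₁ m₂ dbar
  A := HardInstance.A Lf m₁ m₂ dbar
  b := 0
  Abar := HardInstance.Abar Lf m₁ m₂ dbar
  bbar := 0
  gbar := HardInstance.gbar Lf β m₁ m₂ dbar

end

open Finset

/-! Put M = m₁m₂ = m/3 and number blocks and coordinates from 0.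

Slow propagation. The link from coordinate c to c + 1 is present only in the first third of the
blocks (c even) or in the last third (c odd), and its partial derivatives vanish as long as
coordinate c is zero there. The matrices couple only neighbouring blocks, and the prox of an ℓ¹ norm
keeps zeros. A signal thus moves by at most one block per oracle call, and from coordinate 2 on it
must cross the middle third before each new coordinate. So the last coordinate is zero in every
block before iteration (d̄ - 2)M (`iterates_mem`, `last_coord_eq_zero`).

Stationary points are far. Testing stationarity against v in ker A eliminates the multiplier
(`stationary_test`). A step across a single row of Ā shows Āx = 0, because β outweighs the gradient
(`Abar_eq_zero_of_stationary`). With ‖Ax‖ ≤ ε this makes the blocks almost equal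
(`blocks_close_of_stationary`). A common shift of one coordinate in all blocks is invisible to A and
Ā. Along it the block derivatives add up to a strongly negative number if that coordinate is the
first one of scaled modulus below 1. Hence there is no such coordinate
(`one_le_abs_scaledSeq_of_stationary`), and a point with a coordinate vanishing in all blocks lies
at distance at least 150πε/L_f (`far_from_stationary`).

Constants. Since κ ≤ 2m (`jointCond_le`) and Δ ≤ 1800π²ε²d̄/L_f (`gap_le`), the quantity under the
ceiling is at most (3/5)d̄M, and this is at most (d̄ - 2)M because d̄ ≥ 5. -/

theorem lipschitz_real_of_hasDerivAt {f f' : ℝ → ℝ} {C : ℝ} (hf : ∀ x, HasDerivAt f (f' x) x)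
    (hC : ∀ x, |f' x| ≤ C) (a b : ℝ) : |f a - f b| ≤ C * |a - b| := by
  have := Convex.norm_image_sub_le_of_norm_hasDerivWithin_le (f := f) (f' := f') (s := Set.univ)
    (x := b) (y := a) (C := C) (fun x _ => (hf x).hasDerivWithinAt)
    (fun x _ => by simpa using hC x) convex_univ trivial trivial
  simpa using this

theorem abs_mul_sub_mul_le {a b a' b' A B : ℝ} (ha : |a| ≤ A) (hb : |b'| ≤ B) :
    |a * b - a' * b'| ≤ A * |b - b'| + B * |a - a'| := by
  have : a * b - a' * b' = a * (b - b') + b' * (a - a') := by ring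
  rw [this]
  refine (abs_add_le _ _).trans ?_
  rw [abs_mul, abs_mul]
  gcongr

/-! ### The scalar functions Ψ and Φ: derivatives, bounds, Lipschitz constants -/

namespace HardInstance

/-- The derivative of `Psi`. -/
noncomputable def dPsi (u : ℝ) : ℝ := if u ≤ 0 then 0 else 2 * u * Real.exp (-u ^ 2)

/-- The derivative of `Phi`. -/
noncomputable def dPhi (v : ℝ) : ℝ := 4 / (1 + v ^ 2)

theorem Psi_eq (u : ℝ) : Psi u = 1 - Real.exp (-(max u 0) ^ 2) := by
  unfold Psi
  split_ifs with h
  · rw [max_eq_right h]; simp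
  · rw [max_eq_left (not_le.1 h).le]

theorem dPsi_eq (u : ℝ) : dPsi u = 2 * max u 0 * Real.exp (-(max u 0) ^ 2) := by
  unfold dPsi
  split_ifs with h
  · rw [max_eq_right h]; simp
  · rw [max_eq_left (not_le.1 h).le]

theorem Psi_nonneg (u : ℝ) : 0 ≤ Psi u := by
  rw [Psi_eq, sub_nonneg, Real.exp_le_one_iff]
  nlinarith [sq_nonneg (max u 0)]

theorem Psi_le_one (u : ℝ) : Psi u ≤ 1 := by
  rw [Psi_eq]; linarith [Real.exp_pos (-(max u 0) ^ 2)]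

theorem Psi_zero : Psi 0 = 0 := by simp [Psi]

theorem Psi_of_nonpos {u : ℝ} (h : u ≤ 0) : Psi u = 0 := by simp [Psi, h]

theorem Psi_lower {u : ℝ} (h : 1 ≤ u) : 3 / 5 ≤ Psi u := by
  rw [Psi_eq, max_eq_left (by linarith)]
  have h1 : Real.exp (-u ^ 2) ≤ Real.exp (-1) := Real.exp_le_exp.2 (by nlinarith)
  have h2 := Real.exp_neg_one_lt_d9
  linarith

theorem dPsi_nonneg (u : ℝ) : 0 ≤ dPsi u := by
  rw [dPsi_eq]; positivity

theorem dPsi_zero : dPsi 0 = 0 := by simp [dPsi]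

theorem dPsi_of_nonpos {u : ℝ} (h : u ≤ 0) : dPsi u = 0 := by simp [dPsi, h]

theorem dPsi_le_one (u : ℝ) : dPsi u ≤ 1 := by
  rw [dPsi_eq]
  set v := max u 0
  have h1 : v ^ 2 + 1 ≤ Real.exp (v ^ 2) := Real.add_one_le_exp _
  rw [Real.exp_neg, ← div_eq_mul_inv, div_le_one (Real.exp_pos _)]
  nlinarith [sq_nonneg (v - 1)]

theorem abs_dPsi_le (u : ℝ) : |dPsi u| ≤ 1 := by
  rw [abs_of_nonneg (dPsi_nonneg u)]; exact dPsi_le_one u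

theorem hasDerivAt_Psi (u : ℝ) : HasDerivAt Psi (dPsi u) u := by
  have key (v : ℝ) : HasDerivAt (fun u : ℝ => 1 - Real.exp (-u ^ 2))
      (2 * v * Real.exp (-v ^ 2)) v := by
    have h := ((hasDerivAt_pow 2 v).neg.exp).const_sub 1
    refine h.congr_deriv ?_
    simp; ring
  rcases lt_trichotomy u 0 with h | rfl | h
  · rw [dPsi_of_nonpos h.le]
    refine (hasDerivAt_const u (0 : ℝ)).congr_of_eventuallyEq ?_
    filter_upwards [Iio_mem_nhds h] with v hv using Psi_of_nonpos (le_of_lt hv)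
  · rw [dPsi_zero]
    -- At the junction, 0 ≤ Ψ(x) ≤ x² forces the derivative to be zero.
    have hO : Psi =O[nhds 0] fun x : ℝ => ‖x - 0‖ ^ 2 := by
      refine Asymptotics.IsBigO.of_bound 1 (Filter.Eventually.of_forall fun x => ?_)
      rw [Real.norm_of_nonneg (Psi_nonneg x), Psi_eq]
      have h1 := Real.add_one_le_exp (-(max x 0) ^ 2)
      have h2 : (max x 0) ^ 2 ≤ x ^ 2 := by
        rcases le_total x 0 with hx | hx
        · rw [max_eq_right hx]; simpa using sq_nonneg x
        · rw [max_eq_left hx]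
      simp only [sub_zero, Real.norm_eq_abs, sq_abs, abs_pow, one_mul]
      linarith
    have := hO.hasFDerivAt (𝕜 := ℝ) (by norm_num)
    have h2 := this.hasDerivAt
    simpa using h2
  · have : dPsi u = 2 * u * Real.exp (-u ^ 2) := by simp [dPsi, h]
    rw [this]
    refine (key u).congr_of_eventuallyEq ?_
    filter_upwards [Ioi_mem_nhds h] with v hv
    have : ¬ v ≤ 0 := not_le.2 hv
    simp [Psi, this]

theorem Psi_lipschitz (a b : ℝ) : |Psi a - Psi b| ≤ |a - b| := by
  simpa using lipschitz_real_of_hasDerivAt hasDerivAt_Psi abs_dPsi_le a b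

theorem dPsi_lipschitz (a b : ℝ) : |dPsi a - dPsi b| ≤ 2 * |a - b| := by
  have hd (v : ℝ) : HasDerivAt (fun u : ℝ => 2 * u * Real.exp (-u ^ 2))
      ((2 - 4 * v ^ 2) * Real.exp (-v ^ 2)) v := by
    have h := ((hasDerivAt_id v).const_mul 2).mul (hasDerivAt_pow 2 v).neg.exp
    refine h.congr_deriv ?_
    simp; ring
  have hb (v : ℝ) : |(2 - 4 * v ^ 2) * Real.exp (-v ^ 2)| ≤ 2 := by
    rw [abs_mul, abs_of_pos (Real.exp_pos _), Real.exp_neg, ← div_eq_mul_inv,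
      div_le_iff₀ (Real.exp_pos _)]
    have h0 := sq_nonneg v
    -- With s = v², the bound |2 - 4s| ≤ 2eˢ follows from 1 + s + s²/2 ≤ eˢ.
    have h1 := Real.quadratic_le_exp_of_nonneg h0
    rw [abs_le]
    constructor <;> nlinarith [sq_nonneg (v ^ 2 - 1)]
  rw [dPsi_eq, dPsi_eq]
  refine (lipschitz_real_of_hasDerivAt hd hb (max a 0) (max b 0)).trans ?_
  gcongr 2 * ?_
  simpa using abs_max_sub_max_le_max a 0 b 0

theorem Phi_nonneg (v : ℝ) : 0 ≤ Phi v := by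
  unfold Phi; linarith [Real.neg_pi_div_two_lt_arctan v]

theorem Phi_le (v : ℝ) : Phi v ≤ 4 * Real.pi := by
  unfold Phi; linarith [Real.arctan_lt_pi_div_two v]

theorem abs_Phi_le (v : ℝ) : |Phi v| ≤ 4 * Real.pi := by
  rw [abs_of_nonneg (Phi_nonneg v)]; exact Phi_le v

theorem abs_Psi_le (v : ℝ) : |Psi v| ≤ 1 := by
  rw [abs_of_nonneg (Psi_nonneg v)]; exact Psi_le_one v

theorem dPhi_nonneg (v : ℝ) : 0 ≤ dPhi v := by unfold dPhi; positivity

theorem dPhi_le (v : ℝ) : dPhi v ≤ 4 := by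
  unfold dPhi
  rw [div_le_iff₀ (by positivity)]
  nlinarith [sq_nonneg v]

theorem abs_dPhi_le (v : ℝ) : |dPhi v| ≤ 4 := by
  rw [abs_of_nonneg (dPhi_nonneg v)]; exact dPhi_le v

theorem dPhi_lower {v : ℝ} (h : |v| ≤ 1) : 2 ≤ dPhi v := by
  unfold dPhi
  rw [le_div_iff₀ (by positivity)]
  have := (sq_le_one_iff_abs_le_one v).2 h
  linarith

theorem hasDerivAt_Phi (v : ℝ) : HasDerivAt Phi (dPhi v) v := by
  have h := ((Real.hasDerivAt_arctan v).const_mul 4).add_const (2 * Real.pi)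
  refine h.congr_deriv ?_
  unfold dPhi; ring

theorem Phi_lipschitz (a b : ℝ) : |Phi a - Phi b| ≤ 4 * |a - b| :=
  lipschitz_real_of_hasDerivAt hasDerivAt_Phi abs_dPhi_le a b

theorem dPhi_lipschitz (a b : ℝ) : |dPhi a - dPhi b| ≤ 4 * |a - b| := by
  have : dPhi a - dPhi b = 4 * (b + a) / ((1 + a ^ 2) * (1 + b ^ 2)) * (b - a) := by
    unfold dPhi
    have h1 : 1 + a ^ 2 ≠ 0 := by positivity
    have h2 : 1 + b ^ 2 ≠ 0 := by positivity
    field_simp; ring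
  rw [this, abs_mul, abs_sub_comm b a]
  gcongr
  have hp : 0 < (1 + a ^ 2) * (1 + b ^ 2) := by positivity
  rw [abs_div, abs_of_pos hp, div_le_iff₀ hp, abs_le]
  -- From |a| ≤ a² + 1/4, and likewise for b, |a + b| ≤ (1 + a²)(1 + b²).
  constructor <;>
    nlinarith [sq_nonneg (a + 1 / 2), sq_nonneg (a - 1 / 2), sq_nonneg (b + 1 / 2),
      sq_nonneg (b - 1 / 2), mul_nonneg (sq_nonneg a) (sq_nonneg b)]

/-! ### One link of the chain -/

/-- The link `(u, v) ↦ Ψ(-u) Φ(-v) - Ψ(u) Φ(v)` between consecutive coordinates. -/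
noncomputable def pairFun (u v : ℝ) : ℝ := Psi (-u) * Phi (-v) - Psi u * Phi v

/-- The first partial derivative of `pairFun`. -/
noncomputable def pairFunU (u v : ℝ) : ℝ := -(dPsi (-u) * Phi (-v)) - dPsi u * Phi v

/-- The second partial derivative of `pairFun`. -/
noncomputable def pairFunV (u v : ℝ) : ℝ := -(Psi (-u) * dPhi (-v)) - Psi u * dPhi v

theorem pairFun_lower (u v : ℝ) : -(4 * Real.pi) ≤ pairFun u v := by
  unfold pairFun
  have h1 := mul_nonneg (Psi_nonneg (-u)) (Phi_nonneg (-v))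
  have h2 : Psi u * Phi v ≤ 1 * (4 * Real.pi) :=
    mul_le_mul (Psi_le_one u) (Phi_le v) (Phi_nonneg v) zero_le_one
  linarith

theorem pairFun_zero (v : ℝ) : pairFun 0 v = 0 := by simp [pairFun, Psi_zero]

/-- With `pairFunV_zero`, this is the zero-chain property: a link whose first coordinate is still
zero contributes nothing to the gradient. It holds because Ψ is flat to first order at 0. -/
theorem pairFunU_zero (v : ℝ) : pairFunU 0 v = 0 := by simp [pairFunU, dPsi_zero]

theorem pairFunV_zero (v : ℝ) : pairFunV 0 v = 0 := by simp [pairFunV, Psi_zero]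

theorem pairFunU_nonpos (u v : ℝ) : pairFunU u v ≤ 0 := by
  unfold pairFunU
  have h1 := mul_nonneg (dPsi_nonneg (-u)) (Phi_nonneg (-v))
  have h2 := mul_nonneg (dPsi_nonneg u) (Phi_nonneg v)
  linarith

/-- Only one of Ψ'(u) and Ψ'(-u) can be nonzero, so the bounds of the two terms need not be added.
-/
theorem abs_pairFunU_le (u v : ℝ) : |pairFunU u v| ≤ 4 * Real.pi := by
  rw [abs_of_nonpos (pairFunU_nonpos u v)]
  have key (a b : ℝ) : dPsi a * Phi b ≤ 1 * (4 * Real.pi) :=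
    mul_le_mul (dPsi_le_one a) (Phi_le b) (Phi_nonneg b) zero_le_one
  unfold pairFunU
  rcases le_total u 0 with h | h
  · rw [dPsi_of_nonpos h]; linarith [key (-u) (-v)]
  · rw [dPsi_of_nonpos (neg_nonpos.2 h)]; linarith [key u v]

theorem abs_pairFunV_le (u v : ℝ) : |pairFunV u v| ≤ 4 := by
  have key (a b : ℝ) : Psi a * dPhi b ≤ 1 * 4 :=
    mul_le_mul (Psi_le_one a) (dPhi_le b) (dPhi_nonneg b) zero_le_one
  have key' (a b : ℝ) : 0 ≤ Psi a * dPhi b := mul_nonneg (Psi_nonneg a) (dPhi_nonneg b)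
  unfold pairFunV
  rw [abs_le]
  rcases le_total u 0 with h | h
  · rw [Psi_of_nonpos h]; constructor <;> linarith [key (-u) (-v), key' (-u) (-v)]
  · rw [Psi_of_nonpos (neg_nonpos.2 h)]; constructor <;> linarith [key u v, key' u v]

/-- An active link pushes its second coordinate away from [-1, 1]: the constant is (3/5)·2, from Ψ ≥
3/5 on [1, ∞) and Φ' ≥ 2 on [-1, 1]. -/
theorem pairFunV_le {u v : ℝ} (hu : 1 ≤ |u|) (hv : |v| ≤ 1) : pairFunV u v ≤ -(6 / 5) := by
  have key (a b : ℝ) (ha : 1 ≤ a) (hb : |b| ≤ 1) : 3 / 5 * 2 ≤ Psi a * dPhi b :=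
    mul_le_mul (Psi_lower ha) (dPhi_lower hb) (by norm_num) (Psi_nonneg a)
  have key' (a b : ℝ) : 0 ≤ Psi a * dPhi b := mul_nonneg (Psi_nonneg a) (dPhi_nonneg b)
  unfold pairFunV
  rcases le_abs.1 hu with h | h
  · linarith [key u v h hv, key' (-u) (-v)]
  · linarith [key (-u) (-v) h (by rwa [abs_neg]), key' u v]

theorem pairFunU_lipschitz (u v u' v' : ℝ) :
    |pairFunU u v - pairFunU u' v'| ≤ 16 * Real.pi * |u - u'| + 8 * |v - v'| := by
  have key (u v u' v' : ℝ) : |dPsi u * Phi v - dPsi u' * Phi v'|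
      ≤ 8 * Real.pi * |u - u'| + 4 * |v - v'| := by
    have h := abs_mul_sub_mul_le (b := Phi v) (a' := dPsi u') (abs_dPsi_le u) (abs_Phi_le v')
    have := Phi_lipschitz v v'
    have h2 := mul_le_mul_of_nonneg_left (dPsi_lipschitz u u') (by positivity : 0 ≤ 4 * Real.pi)
    linarith
  have h1 := key u v u' v'
  have h2 := key (-u) (-v) (-u') (-v')
  rw [neg_sub_neg, neg_sub_neg, abs_sub_comm u' u, abs_sub_comm v' v] at h2
  unfold pairFunU
  rw [abs_le] at *
  constructor <;> linarith [h1.1, h1.2, h2.1, h2.2]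

theorem pairFunV_lipschitz (u v u' v' : ℝ) :
    |pairFunV u v - pairFunV u' v'| ≤ 8 * |u - u'| + 8 * |v - v'| := by
  have key (u v u' v' : ℝ) : |Psi u * dPhi v - Psi u' * dPhi v'|
      ≤ 4 * |u - u'| + 4 * |v - v'| := by
    have h := abs_mul_sub_mul_le (b := dPhi v) (a' := Psi u') (abs_Psi_le u) (abs_dPhi_le v')
    have := dPhi_lipschitz v v'
    have := Psi_lipschitz u u'
    linarith
  have h1 := key u v u' v'
  have h2 := key (-u) (-v) (-u') (-v')
  rw [neg_sub_neg, neg_sub_neg, abs_sub_comm u' u, abs_sub_comm v' v] at h2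
  unfold pairFunV
  rw [abs_le] at *
  constructor <;> linarith [h1.1, h1.2, h2.1, h2.2]

theorem hasFDerivAt_pairFun {E : Type*} [NormedAddCommGroup E] [NormedSpace ℝ E]
    {a b : E → ℝ} {a' b' : E →L[ℝ] ℝ} {x : E} (ha : HasFDerivAt a a' x) (hb : HasFDerivAt b b' x) :
    HasFDerivAt (fun x => pairFun (a x) (b x))
      (pairFunU (a x) (b x) • a' + pairFunV (a x) (b x) • b') x := by
  have h1 := ((hasDerivAt_Psi (-a x)).comp_hasFDerivAt x ha.neg).mul
    ((hasDerivAt_Phi (-b x)).comp_hasFDerivAt x hb.neg)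
  have h2 := ((hasDerivAt_Psi (a x)).comp_hasFDerivAt x ha).mul
    ((hasDerivAt_Phi (b x)).comp_hasFDerivAt x hb)
  refine (h1.sub h2).congr_fderiv ?_
  ext v
  simp [pairFunU, pairFunV]
  ring

/-! ### Chain functions with weighted links -/

/-- The sum of the first term and of the weighted links of a sequence. -/
noncomputable def chainFun (w : ℕ → ℝ) (d : ℕ) (z : ℕ → ℝ) : ℝ :=
  -Psi 1 * Phi (z 0) + ∑ c ∈ range d, w c * pairFun (z c) (z (c + 1))

/-- The partial derivatives of `chainFun`. -/
noncomputable def chainGrad (w : ℕ → ℝ) (z : ℕ → ℝ) : ℕ → ℝ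
  | 0 => -Psi 1 * dPhi (z 0) + w 0 * pairFunU (z 0) (z 1)
  | c + 1 => w c * pairFunV (z c) (z (c + 1)) + w (c + 1) * pairFunU (z (c + 1)) (z (c + 2))

/-- The weights of the links in block `i`, where `M` is a third of the number of blocks. -/
noncomputable def weight (M d i c : ℕ) : ℝ :=
  if c + 1 < d ∧ ((i < M ∧ Even c) ∨ (2 * M ≤ i ∧ Odd c)) then 3 else 0

theorem weight_nonneg (M d i c : ℕ) : 0 ≤ weight M d i c := by
  unfold weight; split_ifs <;> norm_num

theorem weight_le (M d i c : ℕ) : weight M d i c ≤ 3 := by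
  unfold weight; split_ifs <;> norm_num

theorem weight_eq_zero {M d i c : ℕ} (h : d ≤ c + 1) : weight M d i c = 0 := by
  unfold weight; rw [if_neg]; omega

/-- Each link lives in exactly one third of the blocks, with weight 3. The average weight is
therefore 1, and equal blocks together behave like m copies of the full chain. -/
theorem sum_weight {M d c : ℕ} (h : c + 1 < d) :
    ∑ i ∈ range (3 * M), weight M d i c = 3 * M := by
  have e : range (3 * M) = range (M + M + M) := by congr 1; ring
  rw [e, sum_range_add, sum_range_add]
  rcases Nat.even_or_odd c with hc | hc
  · have hc' := Nat.not_odd_iff_even.2 hc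
    have h1 : ∑ i ∈ range M, weight M d i c = ∑ i ∈ range M, 3 :=
      sum_congr rfl fun i hi => by simp [weight, h, hc, mem_range.1 hi]
    have h2 : ∑ i ∈ range M, weight M d (M + i) c = 0 :=
      sum_eq_zero fun i hi => by simp [weight, hc']
    have h3 : ∑ i ∈ range M, weight M d (M + M + i) c = 0 :=
      sum_eq_zero fun i hi => by simp [weight, hc']; intros; omega
    rw [h1, h2, h3]; simp; ring
  · have hc' := Nat.not_even_iff_odd.2 hc
    have h1 : ∑ i ∈ range M, weight M d i c = 0 :=
      sum_eq_zero fun i hi => by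
        have := mem_range.1 hi
        simp [weight, hc']; intros; omega
    have h2 : ∑ i ∈ range M, weight M d (M + i) c = 0 :=
      sum_eq_zero fun i hi => by
        have := mem_range.1 hi
        simp [weight, hc']; intros; omega
    have h3 : ∑ i ∈ range M, weight M d (M + M + i) c = ∑ i ∈ range M, 3 :=
      sum_congr rfl fun i hi => by
        have : 2 * M ≤ M + M + i := by omega
        simp [weight, h, hc, this]
    rw [h1, h2, h3]; simp; ring

theorem sum_range_two_mul {R : Type*} [AddCommMonoid R] (F : ℕ → R) (k : ℕ) :
    ∑ c ∈ range (2 * k), F c = ∑ j ∈ range k, (F (2 * j) + F (2 * j + 1)) := by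
  induction k with
  | zero => simp
  | succ k ih => rw [sum_range_succ, ← ih, mul_add, sum_range_succ, sum_range_succ, add_assoc]

theorem phi_one {d : ℕ} (z : Fin d → ℝ) : phi z 1 = -Psi 1 * Phi (coord z 1) := by simp [phi]

theorem phi_add_two {d : ℕ} (z : Fin d → ℝ) (c : ℕ) :
    phi z (c + 2) = pairFun (coord z (c + 1)) (coord z (c + 2)) := by
  simp [phi, pairFun]

/-- In 0-based numbering, φ(·, j) is the link from j - 2 to j - 1, so even j gives even links and
odd j odd ones. Oddness of d makes both families end inside the block. -/
theorem h_eq_chainFun {m₁ m₂ d : ℕ} (hd : Odd d) (i : Fin (3 * m₁ * m₂)) (z : Fin d → ℝ) :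
    h i z = chainFun (weight (m₁ * m₂) d i) d (fun c => coord z (c + 1)) := by
  obtain ⟨k, rfl⟩ := hd
  have hk : (2 * k + 1) / 2 = k := by omega
  unfold h chainFun
  rw [hk, sum_range_succ, weight_eq_zero le_rfl, zero_mul, add_zero, sum_range_two_mul, phi_one]
  have hI (F : ℕ → ℝ) : ∑ j ∈ Icc 1 k, F j = ∑ j ∈ range k, F (j + 1) := by
    rw [range_eq_Ico, sum_Ico_add' F 0 k 1]; rfl
  split_ifs with h1 h2
  · congr 1
    rw [hI, mul_sum]
    refine sum_congr rfl fun j hj => ?_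
    have hj := mem_range.1 hj
    have e1 : weight (m₁ * m₂) (2 * k + 1) i (2 * j) = 3 := by
      rw [weight, if_pos ⟨by omega, Or.inl ⟨h1, even_two_mul j⟩⟩]
    have e2 : weight (m₁ * m₂) (2 * k + 1) i (2 * j + 1) = 0 := by
      rw [weight, if_neg]
      rintro ⟨-, ⟨-, h⟩ | ⟨h, -⟩⟩
      · exact Nat.not_even_iff_odd.2 (odd_two_mul_add_one j) h
      · omega
    rw [e1, e2, mul_add, mul_one, phi_add_two]; simp
  · rw [sum_eq_zero, add_zero]
    intro j hj
    have e (c : ℕ) : weight (m₁ * m₂) (2 * k + 1) i c = 0 := by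
      rw [weight, if_neg]; omega
    rw [e, e]; simp
  · congr 1
    rw [hI, mul_sum]
    refine sum_congr rfl fun j hj => ?_
    have hj := mem_range.1 hj
    have e1 : weight (m₁ * m₂) (2 * k + 1) i (2 * j) = 0 := by
      rw [weight, if_neg]
      rintro ⟨-, ⟨h, -⟩ | ⟨-, h⟩⟩
      · omega
      · exact Nat.not_even_iff_odd.2 h (even_two_mul j)
    have e2 : weight (m₁ * m₂) (2 * k + 1) i (2 * j + 1) = 3 := by
      rw [weight, if_pos ⟨by omega, Or.inr ⟨by omega, odd_two_mul_add_one j⟩⟩]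
    have : 2 * (j + 1) + 1 = 2 * j + 1 + 2 := by ring
    rw [e1, e2, this, phi_add_two]; simp

/-- Each coordinate receives one term from the link it starts and one from the link it ends. The
last link of the sum leaves the block, and `hw` removes it. -/
theorem hasFDerivAt_chainFun {E : Type*} [NormedAddCommGroup E] [NormedSpace ℝ E]
    {w : ℕ → ℝ} {d : ℕ} (hw : w d = 0) {a : ℕ → E → ℝ} {a' : ℕ → E →L[ℝ] ℝ} {x : E}
    (ha : ∀ c, HasFDerivAt (a c) (a' c) x) :
    HasFDerivAt (fun x => chainFun w (d + 1) (fun c => a c x))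
      (∑ c ∈ range (d + 1), chainGrad w (fun c => a c x) c • a' c) x := by
  have h1 := ((hasDerivAt_Phi (a 0 x)).comp_hasFDerivAt x (ha 0)).const_mul (-Psi 1)
  have h2 := HasFDerivAt.fun_sum (u := range (d + 1)) fun c _ =>
    (hasFDerivAt_pairFun (ha c) (ha (c + 1))).const_mul (w c)
  refine (h1.add h2).congr_fderiv ?_
  simp only [smul_add, sum_add_distrib]
  rw [sum_range_succ' (fun c => w c • pairFunU (a c x) (a (c + 1) x) • a' c),
    sum_range_succ (fun c => w c • pairFunV (a c x) (a (c + 1) x) • a' (c + 1)), hw,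
    sum_range_succ']
  simp only [chainGrad, add_smul, sum_add_distrib, mul_smul, zero_smul, add_zero]
  abel

theorem abs_chainGrad_sub_le {w : ℕ → ℝ} (h0 : ∀ c, 0 ≤ w c) (h3 : ∀ c, w c ≤ 3)
    (z z' : ℕ → ℝ) (c : ℕ) :
    |chainGrad w z c - chainGrad w z' c| ≤ 24 * (if c = 0 then 0 else |z (c - 1) - z' (c - 1)|)
      + (28 + 48 * Real.pi) * |z c - z' c| + 24 * |z (c + 1) - z' (c + 1)| := by
  have hU (c : ℕ) : |w c * pairFunU (z c) (z (c + 1)) - w c * pairFunU (z' c) (z' (c + 1))|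
      ≤ 3 * (16 * Real.pi * |z c - z' c| + 8 * |z (c + 1) - z' (c + 1)|) := by
    rw [← mul_sub, abs_mul, abs_of_nonneg (h0 c)]
    exact mul_le_mul (h3 c) (pairFunU_lipschitz _ _ _ _) (abs_nonneg _) (by norm_num)
  have hV (c : ℕ) : |w c * pairFunV (z c) (z (c + 1)) - w c * pairFunV (z' c) (z' (c + 1))|
      ≤ 3 * (8 * |z c - z' c| + 8 * |z (c + 1) - z' (c + 1)|) := by
    rw [← mul_sub, abs_mul, abs_of_nonneg (h0 c)]
    exact mul_le_mul (h3 c) (pairFunV_lipschitz _ _ _ _) (abs_nonneg _) (by norm_num)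
  rcases c with _ | c
  · have h1 : |-Psi 1 * dPhi (z 0) - -Psi 1 * dPhi (z' 0)| ≤ 4 * |z 0 - z' 0| := by
      rw [← mul_sub, abs_mul, abs_neg]
      have := mul_le_mul (abs_Psi_le 1) (dPhi_lipschitz (z 0) (z' 0)) (abs_nonneg _) zero_le_one
      linarith
    have h2 := hU 0
    simp only [chainGrad, if_true, zero_add] at *
    have := abs_add_le (-Psi 1 * dPhi (z 0) - -Psi 1 * dPhi (z' 0))
      (w 0 * pairFunU (z 0) (z 1) - w 0 * pairFunU (z' 0) (z' 1))
    rw [add_sub_add_comm]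
    nlinarith [abs_nonneg (z 0 - z' 0)]
  · have h1 := hV c
    have h2 := hU (c + 1)
    simp only [chainGrad, Nat.succ_ne_zero, if_false, Nat.add_sub_cancel] at *
    rw [add_sub_add_comm]
    refine (abs_add_le _ _).trans ?_
    nlinarith [abs_nonneg (z (c + 1) - z' (c + 1))]

theorem abs_chainGrad_le {w : ℕ → ℝ} (h0 : ∀ c, 0 ≤ w c) (h3 : ∀ c, w c ≤ 3)
    (z : ℕ → ℝ) (c : ℕ) : |chainGrad w z c| ≤ 16 + 12 * Real.pi := by
  have hU (c : ℕ) : |w c * pairFunU (z c) (z (c + 1))| ≤ 3 * (4 * Real.pi) := by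
    rw [abs_mul, abs_of_nonneg (h0 c)]
    exact mul_le_mul (h3 c) (abs_pairFunU_le _ _) (abs_nonneg _) (by norm_num)
  rcases c with _ | c
  · have h1 : |-Psi 1 * dPhi (z 0)| ≤ 1 * 4 := by
      rw [abs_mul, abs_neg]
      exact mul_le_mul (abs_Psi_le 1) (abs_dPhi_le _) (abs_nonneg _) zero_le_one
    have := hU 0
    unfold chainGrad
    refine (abs_add_le _ _).trans ?_
    simp only [zero_add] at *
    linarith
  · have h1 : |w c * pairFunV (z c) (z (c + 1))| ≤ 3 * 4 := by
      rw [abs_mul, abs_of_nonneg (h0 c)]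
      exact mul_le_mul (h3 c) (abs_pairFunV_le _ _) (abs_nonneg _) (by norm_num)
    have := hU (c + 1)
    unfold chainGrad
    refine (abs_add_le _ _).trans ?_
    linarith

/-- Schur's test for a tridiagonal matrix with entries 24, 28 + 48π, 24: the pointwise bound is
convexity of the square with these weights, and the shifted sums are again bounded by the unshifted
one. `hz` closes the right end, where the shift would leave the range. -/
theorem sum_chainGrad_sub_sq_le {w : ℕ → ℝ} (h0 : ∀ c, 0 ≤ w c) (h3 : ∀ c, w c ≤ 3)
    {z z' : ℕ → ℝ} {d : ℕ} (hz : z d = z' d) :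
    ∑ c ∈ range d, (chainGrad w z c - chainGrad w z' c) ^ 2
      ≤ (75 * Real.pi) ^ 2 * ∑ c ∈ range d, (z c - z' c) ^ 2 := by
  set D : ℕ → ℝ := fun c => |z c - z' c| with hD
  set E : ℕ → ℝ := fun c => if c = 0 then 0 else D (c - 1) with hE
  set K : ℝ := 76 + 48 * Real.pi with hK
  have hpi := Real.pi_gt_three
  have hpt (c : ℕ) : (chainGrad w z c - chainGrad w z' c) ^ 2
      ≤ K * (24 * E c ^ 2 + (28 + 48 * Real.pi) * D c ^ 2 + 24 * D (c + 1) ^ 2) := by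
    have h := abs_chainGrad_sub_le h0 h3 z z' c
    have h' := pow_le_pow_left₀ (abs_nonneg _) h 2
    rw [sq_abs] at h'
    change _ ≤ (24 * E c + (28 + 48 * Real.pi) * D c + 24 * D (c + 1)) ^ 2 at h'
    refine h'.trans ?_
    rw [hK]
    nlinarith [sq_nonneg (E c - D (c + 1)),
      mul_nonneg (by positivity : 0 ≤ 28 + 48 * Real.pi) (sq_nonneg (E c - D c)),
      mul_nonneg (by positivity : 0 ≤ 28 + 48 * Real.pi) (sq_nonneg (D (c + 1) - D c))]
  have hS1 : ∑ c ∈ range d, E c ^ 2 ≤ ∑ c ∈ range d, D c ^ 2 := by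
    rcases d with _ | d
    · simp
    · rw [sum_range_succ']
      have : ∑ c ∈ range d, E (c + 1) ^ 2 = ∑ c ∈ range d, D c ^ 2 :=
        sum_congr rfl fun c _ => by simp [hE]
      rw [this, sum_range_succ]
      have : E 0 = 0 := by simp [hE]
      rw [this]
      nlinarith [sq_nonneg (D d)]
  have hS2 : ∑ c ∈ range d, D (c + 1) ^ 2 ≤ ∑ c ∈ range d, D c ^ 2 := by
    have h1 := sum_range_succ' (fun c => D c ^ 2) d
    rw [sum_range_succ] at h1
    have : D d = 0 := by simp [hD, hz]
    rw [this] at h1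
    nlinarith [sq_nonneg (D 0)]
  have hS3 : ∑ c ∈ range d, D c ^ 2 = ∑ c ∈ range d, (z c - z' c) ^ 2 :=
    sum_congr rfl fun c _ => sq_abs _
  have hS0 : 0 ≤ ∑ c ∈ range d, D c ^ 2 := sum_nonneg fun c _ => sq_nonneg _
  calc _ ≤ ∑ c ∈ range d, K * (24 * E c ^ 2 + (28 + 48 * Real.pi) * D c ^ 2 + 24 * D (c + 1) ^ 2) :=
        sum_le_sum fun c _ => hpt c
    _ = K * (24 * ∑ c ∈ range d, E c ^ 2 + (28 + 48 * Real.pi) * ∑ c ∈ range d, D c ^ 2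
          + 24 * ∑ c ∈ range d, D (c + 1) ^ 2) := by
        simp only [mul_sum, ← sum_add_distrib]
    _ ≤ K * (K * ∑ c ∈ range d, D c ^ 2) := by
        gcongr
        rw [hK]; nlinarith
    _ ≤ _ := by
        rw [hS3] at *
        rw [← mul_assoc, ← sq]
        gcongr
        -- 76 + 48π ≤ 75π, because 27π > 81.
        rw [hK]; linarith

theorem chainFun_lower {w : ℕ → ℝ} (h0 : ∀ c, 0 ≤ w c) (h3 : ∀ c, w c ≤ 3) (d : ℕ) (z : ℕ → ℝ) :
    -(4 * Real.pi) - 12 * Real.pi * #{c ∈ range d | w c ≠ 0} ≤ chainFun w d z := by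
  have h1 : Psi 1 * Phi (z 0) ≤ 1 * (4 * Real.pi) :=
    mul_le_mul (Psi_le_one 1) (Phi_le _) (Phi_nonneg _) zero_le_one
  have h2 : ∑ c ∈ range d with w c ≠ 0, (-(12 * Real.pi)) ≤
      ∑ c ∈ range d, w c * pairFun (z c) (z (c + 1)) := by
    rw [sum_filter]
    refine sum_le_sum fun c _ => ?_
    split_ifs with hc
    · have h4 := mul_le_mul_of_nonneg_left (pairFun_lower (z c) (z (c + 1))) (h0 c)
      nlinarith [h3 c, Real.pi_pos]
    · simp [not_not.1 hc]
  rw [sum_const, nsmul_eq_mul] at h2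
  unfold chainFun
  linarith

/-- In a given block all active links have the same parity, so c ↦ c / 2 is injective on them. -/
theorem card_weight_ne_zero_le {M d i : ℕ} (hd : Odd d) :
    2 * #{c ∈ range d | weight M d i c ≠ 0} + 1 ≤ d := by
  obtain ⟨k, rfl⟩ := hd
  have key (c : ℕ) (h : weight M (2 * k + 1) i c ≠ 0) :
      c + 1 < 2 * k + 1 ∧ ((i < M ∧ Even c) ∨ (2 * M ≤ i ∧ Odd c)) := by
    by_contra h'
    exact h (if_neg h')
  have : #{c ∈ range (2 * k + 1) | weight M (2 * k + 1) i c ≠ 0} ≤ #(range k) := by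
    refine card_le_card_of_injOn (· / 2) ?_ ?_
    · intro c hc
      have := key c (mem_filter.1 hc).2
      simp only [coe_range, Set.mem_Iio]
      omega
    · intro a ha b hb hab
      have ha := key a (mem_filter.1 ha).2
      have hb := key b (mem_filter.1 hb).2
      simp only [Nat.even_iff, Nat.odd_iff] at ha hb hab
      omega
  rw [card_range] at this
  omega

theorem chainFun_weight_lower {M d i : ℕ} (hd : Odd d) (z : ℕ → ℝ) :
    -(6 * Real.pi * d) ≤ chainFun (weight M d i) d z := by
  have h1 := chainFun_lower (weight_nonneg M d i) (weight_le M d i) d z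
  have h2 : (2 * (#{c ∈ range d | weight M d i c ≠ 0} : ℝ) + 1) ≤ d := by
    exact_mod_cast card_weight_ne_zero_le (M := M) (i := i) hd
  nlinarith [Real.pi_pos]

/-! ### The smooth part: gradient, Lipschitz constant, lower bound -/

theorem coord_smul {d : ℕ} (s : ℝ) (z : Fin d → ℝ) (j : ℕ) : coord (s • z) j = s * coord z j := by
  unfold coord; split_ifs <;> simp

theorem coord_succ {d : ℕ} (z : Fin d → ℝ) (c : Fin d) : coord z (c + 1) = z c := by
  simp [coord]

theorem coord_succ_self {d : ℕ} (z : Fin d → ℝ) : coord z (d + 1) = 0 := by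
  simp [coord]

/-- The `i`-th block of `x`, as a sequence extended by zero. -/
noncomputable def blockSeq {m d : ℕ} (x : EuclideanSpace ℝ (Fin m × Fin d)) (i : Fin m) (c : ℕ) : ℝ :=
  coord (fun j => x (i, j)) (c + 1)

theorem blockSeq_coe {m d : ℕ} (x : EuclideanSpace ℝ (Fin m × Fin d)) (i : Fin m) (c : Fin d) :
    blockSeq x i c = x (i, c) := coord_succ _ c

theorem blockSeq_self {m d : ℕ} (x : EuclideanSpace ℝ (Fin m × Fin d)) (i : Fin m) :
    blockSeq x i d = 0 := coord_succ_self _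

theorem blockSeq_zero {m d : ℕ} (i : Fin m) (c : ℕ) :
    blockSeq (0 : EuclideanSpace ℝ (Fin m × Fin d)) i c = 0 := by
  simp [blockSeq, coord]

/-- `blockSeq` as a continuous linear functional. -/
noncomputable def blockProj (m d : ℕ) (i : Fin m) (c : ℕ) : EuclideanSpace ℝ (Fin m × Fin d) →L[ℝ] ℝ :=
  if h : c < d then EuclideanSpace.proj (i, ⟨c, h⟩) else 0

theorem blockProj_apply {m d : ℕ} (x : EuclideanSpace ℝ (Fin m × Fin d)) (i : Fin m) (c : ℕ) :
    blockProj m d i c x = blockSeq x i c := by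
  unfold blockProj blockSeq coord
  by_cases h : c < d
  · simp [h]
  · simp [h]

/-- The factor by which the arguments of the chain functions are scaled. -/
noncomputable def scaleFactor (ε Lf : ℝ) (m : ℕ) : ℝ := Real.sqrt m * Lf / (150 * Real.pi * ε)

/-- The scaled `i`-th block of `x`. -/
noncomputable def scaledSeq (ε Lf : ℝ) {m d : ℕ} (x : EuclideanSpace ℝ (Fin m × Fin d)) (i : Fin m)
    (c : ℕ) : ℝ := scaleFactor ε Lf m * blockSeq x i c

theorem f_eq {m₁ m₂ d : ℕ} (hd : Odd d) (ε Lf : ℝ) (x : EuclideanSpace ℝ (Fin (3 * m₁ * m₂) × Fin d))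
    (i : Fin (3 * m₁ * m₂)) :
    f ε Lf i (fun j => x (i, j)) = 300 * Real.pi * ε ^ 2 / (((3 * m₁ * m₂ : ℕ) : ℝ) * Lf) *
      chainFun (weight (m₁ * m₂) d i) d (scaledSeq ε Lf x i) := by
  unfold f
  rw [h_eq_chainFun hd]
  simp only [coord_smul]
  rfl

/-- The gradient of `f0`, in coordinates. -/
noncomputable def f0Grad (ε Lf : ℝ) {m₁ m₂ d : ℕ} (x : EuclideanSpace ℝ (Fin (3 * m₁ * m₂) × Fin d)) :
    EuclideanSpace ℝ (Fin (3 * m₁ * m₂) × Fin d) :=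
  WithLp.toLp 2 fun p => 2 * ε / Real.sqrt (3 * m₁ * m₂ : ℕ) *
    chainGrad (weight (m₁ * m₂) d p.1) (scaledSeq ε Lf x p.1) p.2

section

variable {ε Lf : ℝ} {m₁ m₂ d : ℕ}

theorem hasGradientAt_f0 (hε : 0 < ε) (hLf : 0 < Lf) (hm : 0 < 3 * m₁ * m₂) (hd : Odd d) :
    ∀ x : EuclideanSpace ℝ (Fin (3 * m₁ * m₂) × Fin d),
    HasGradientAt (f0 ε Lf m₁ m₂ d) (f0Grad ε Lf x) x := by
  obtain ⟨d, rfl⟩ : ∃ d', d = d' + 1 := ⟨d - 1, (Nat.sub_add_cancel hd.pos).symm⟩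
  set m := 3 * m₁ * m₂ with hmdef
  intro x
  have hm' : (0 : ℝ) < m := by exact_mod_cast hm
  have hs : 0 < Real.sqrt m := Real.sqrt_pos.2 hm'
  have hfun : f0 ε Lf m₁ m₂ (d + 1) = fun x => ∑ i : Fin m, 300 * Real.pi * ε ^ 2 / (m * Lf) *
      chainFun (weight (m₁ * m₂) (d + 1) i) (d + 1)
        (fun c => scaleFactor ε Lf m * blockProj m (d + 1) i c x) := by
    funext x
    unfold f0
    refine sum_congr rfl fun i _ => ?_
    rw [f_eq hd]
    simp only [blockProj_apply]
    rfl
  rw [hasGradientAt_iff_hasFDerivAt, hfun]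
  have hder := HasFDerivAt.fun_sum (u := (univ : Finset (Fin m))) fun i _ =>
    (hasFDerivAt_chainFun (weight_eq_zero (M := m₁ * m₂) (i := (i : ℕ)) (d := d + 1) (c := d) le_rfl)
      (fun c => ((blockProj m (d + 1) i c).hasFDerivAt (x := x)).const_mul
        (scaleFactor ε Lf m))).const_mul (300 * Real.pi * ε ^ 2 / (m * Lf))
  refine hder.congr_fderiv ?_
  ext v
  have hconst : 300 * Real.pi * ε ^ 2 / (m * Lf) * scaleFactor ε Lf m = 2 * ε / Real.sqrt m := by
    have := Real.pi_pos
    unfold scaleFactor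
    field_simp
    rw [Real.sq_sqrt hm'.le]
    ring
  rw [InnerProductSpace.toDual_apply_apply, PiLp.inner_apply, Fintype.sum_prod_type,
    _root_.sum_apply]
  refine sum_congr rfl fun i _ => ?_
  rw [_root_.smul_apply, _root_.sum_apply, Finset.sum_range, smul_sum]
  refine sum_congr rfl fun c _ => ?_
  have hz : (fun c => scaleFactor ε Lf m * blockProj m (d + 1) i c x) = scaledSeq ε Lf x i := by
    funext c; rw [blockProj_apply]; rfl
  rw [hz]
  simp only [_root_.smul_apply, blockProj_apply, blockSeq_coe, smul_eq_mul, f0Grad,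
    RCLike.inner_apply, conj_trivial]
  change _ = v (i, c) * (2 * ε / Real.sqrt m * _)
  rw [← hconst]
  ring

theorem gradient_f0 (hε : 0 < ε) (hLf : 0 < Lf) (hm : 0 < 3 * m₁ * m₂) (hd : Odd d) :
    gradient (f0 ε Lf m₁ m₂ d) = f0Grad ε Lf :=
  funext fun x => (hasGradientAt_f0 hε hLf hm hd x).gradient

/-- The blocks decouple, and the scalings are chosen so that (2ε/√m) · 75π · (√m L_f/(150πε)) = L_f.
-/
theorem f0Grad_lipschitz (hε : 0 < ε) (hLf : 0 < Lf) (hm : 0 < 3 * m₁ * m₂) :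
    ∀ x x' : EuclideanSpace ℝ (Fin (3 * m₁ * m₂) × Fin d),
    ‖f0Grad ε Lf x - f0Grad ε Lf x'‖ ≤ Lf * ‖x - x'‖ := by
  set m := 3 * m₁ * m₂ with hmdef
  intro x x'
  have hm' : (0 : ℝ) < m := by exact_mod_cast hm
  have hs : 0 < Real.sqrt m := Real.sqrt_pos.2 hm'
  refine (sq_le_sq₀ (norm_nonneg _) (by positivity)).1 ?_
  rw [mul_pow, EuclideanSpace.norm_sq_eq, EuclideanSpace.norm_sq_eq, Fintype.sum_prod_type,
    Fintype.sum_prod_type, mul_sum]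
  refine sum_le_sum fun i _ => ?_
  have key := sum_chainGrad_sub_sq_le (weight_nonneg (m₁ * m₂) d i) (weight_le (m₁ * m₂) d i)
    (z := scaledSeq ε Lf x i) (z' := scaledSeq ε Lf x' i) (d := d)
    (by simp [scaledSeq, blockSeq_self])
  rw [Finset.sum_range, Finset.sum_range] at key
  have h1 : ∑ c : Fin d, ‖(f0Grad ε Lf x - f0Grad ε Lf x') (i, c)‖ ^ 2 =
      (2 * ε / Real.sqrt m) ^ 2 * ∑ c : Fin d, (chainGrad (weight (m₁ * m₂) d i)
        (scaledSeq ε Lf x i) c - chainGrad (weight (m₁ * m₂) d i) (scaledSeq ε Lf x' i) c) ^ 2 := by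
    rw [mul_sum]
    refine sum_congr rfl fun c _ => ?_
    simp only [f0Grad, PiLp.sub_apply, Real.norm_eq_abs, sq_abs]
    ring
  have h2 : ∑ c : Fin d, (scaledSeq ε Lf x i c - scaledSeq ε Lf x' i c) ^ 2 =
      scaleFactor ε Lf m ^ 2 * ∑ c : Fin d, ‖(x - x') (i, c)‖ ^ 2 := by
    rw [mul_sum]
    refine sum_congr rfl fun c _ => ?_
    simp only [scaledSeq, blockSeq_coe, PiLp.sub_apply, Real.norm_eq_abs, sq_abs]
    ring
  rw [h2] at key
  rw [h1]
  refine (mul_le_mul_of_nonneg_left key (sq_nonneg _)).trans (le_of_eq ?_)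
  have hpi := Real.pi_pos
  rw [← mul_assoc, ← mul_assoc, ← mul_pow, ← mul_pow]
  congr 2
  unfold scaleFactor
  field_simp
  norm_num

theorem f0_lower (hε : 0 < ε) (hLf : 0 < Lf) (hm : 0 < 3 * m₁ * m₂) (hd : Odd d) :
    ∀ x : EuclideanSpace ℝ (Fin (3 * m₁ * m₂) × Fin d),
    -(1800 * Real.pi ^ 2 * ε ^ 2 * d / Lf) ≤ f0 ε Lf m₁ m₂ d x := by
  set m := 3 * m₁ * m₂ with hmdef
  intro x
  have hm' : (0 : ℝ) < m := by exact_mod_cast hm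
  have hpi := Real.pi_pos
  have : ∑ i : Fin m, (300 * Real.pi * ε ^ 2 / (m * Lf) * -(6 * Real.pi * d)) ≤
      f0 ε Lf m₁ m₂ d x := by
    unfold f0
    refine sum_le_sum fun i _ => ?_
    rw [f_eq hd]
    exact mul_le_mul_of_nonneg_left (chainFun_weight_lower hd _) (by positivity)
  refine le_trans (le_of_eq ?_) this
  rw [sum_const, card_univ, Fintype.card_fin, nsmul_eq_mul]
  field_simp
  ring

theorem f0_zero_le (hε : 0 < ε) (hLf : 0 < Lf) (hd : Odd d) : f0 ε Lf m₁ m₂ d 0 ≤ 0 := by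
  unfold f0
  refine sum_nonpos fun i _ => ?_
  rw [f_eq hd]
  have hpi := Real.pi_pos
  refine mul_nonpos_of_nonneg_of_nonpos (by positivity) ?_
  have hz : scaledSeq ε Lf (0 : EuclideanSpace ℝ (Fin (3 * m₁ * m₂) × Fin d)) i = fun _ => 0 := by
    funext c; simp [scaledSeq, blockSeq_zero]
  rw [hz]
  simp only [chainFun, pairFun_zero, mul_zero, sum_const_zero, add_zero, neg_mul, neg_nonpos]
  exact mul_nonneg (Psi_nonneg _) (Phi_nonneg _)

end

/-! ### The standing assumptions and the initial gap -/

theorem properLscConvex_coe {E : Type*} [NormedAddCommGroup E] [NormedSpace ℝ E] {q : E → ℝ}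
    (hc : Continuous q) (hq : ConvexOn ℝ Set.univ q) : ProperLscConvex fun x => (q x : EReal) := by
  refine ⟨⟨fun x => EReal.coe_ne_bot _, 0, EReal.coe_ne_top _⟩,
    (continuous_coe_real_ereal.comp hc).lowerSemicontinuous, ?_⟩
  have := hq.convex_epigraph
  simpa using this

/-- The `ℓ¹` norm on a Euclidean space. -/
noncomputable def l1 {ι : Type*} [Fintype ι] (y : EuclideanSpace ℝ ι) : ℝ := ∑ p, |y p|

theorem l1_continuous {ι : Type*} [Fintype ι] : Continuous (l1 (ι := ι)) := by
  unfold l1; fun_prop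

theorem l1_convexOn {ι : Type*} [Fintype ι] : ConvexOn ℝ Set.univ (l1 (ι := ι)) := by
  refine ⟨convex_univ, fun x _ y _ a b ha hb _ => ?_⟩
  simp only [l1, smul_eq_mul, mul_sum, ← sum_add_distrib]
  refine sum_le_sum fun p _ => ?_
  refine (abs_add_le _ _).trans (le_of_eq ?_)
  simp [abs_mul, abs_of_nonneg ha, abs_of_nonneg hb]

theorem l1_nonneg {ι : Type*} [Fintype ι] (y : EuclideanSpace ℝ ι) : 0 ≤ l1 y :=
  sum_nonneg fun _ _ => abs_nonneg _

section

variable {ε Lf β : ℝ} {m₁ m₂ d : ℕ}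

theorem gbar_eq (y : EuclideanSpace ℝ (rowSet m₁ m₂ × Fin d)) :
    gbar Lf β m₁ m₂ d y = ((β / (((3 * m₁ * m₂ : ℕ) : ℝ) * Lf) * l1 y : ℝ) : EReal) := rfl

theorem g_eq (x : EuclideanSpace ℝ (Fin (3 * m₁ * m₂) × Fin d)) :
    (hardInstance ε Lf β m₁ m₂ d).g x =
      ((β / (((3 * m₁ * m₂ : ℕ) : ℝ) * Lf) * l1 (mulVecE (Abar Lf m₁ m₂ d) x) : ℝ) : EReal) := by
  unfold CompositeProblem.g
  change gbar Lf β m₁ m₂ d (mulVecE (Abar Lf m₁ m₂ d) x + 0) = _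
  rw [add_zero, gbar_eq]

theorem F0_eq (x : EuclideanSpace ℝ (Fin (3 * m₁ * m₂) × Fin d)) :
    (hardInstance ε Lf β m₁ m₂ d).F0 x =
      ((f0 ε Lf m₁ m₂ d x +
        β / (((3 * m₁ * m₂ : ℕ) : ℝ) * Lf) * l1 (mulVecE (Abar Lf m₁ m₂ d) x) : ℝ) : EReal) := by
  unfold CompositeProblem.F0
  rw [g_eq, EReal.coe_add]
  rfl

theorem F0_lower (hε : 0 < ε) (hLf : 0 < Lf) (hβ : 0 ≤ β) (hm : 0 < 3 * m₁ * m₂) (hd : Odd d) :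
    ((-(1800 * Real.pi ^ 2 * ε ^ 2 * d / Lf) : ℝ) : EReal) ≤
      ⨅ x, (hardInstance ε Lf β m₁ m₂ d).F0 x := by
  refine le_iInf fun x => ?_
  rw [F0_eq, EReal.coe_le_coe_iff]
  have h1 := f0_lower hε hLf hm hd x
  have h2 : 0 ≤ β / (((3 * m₁ * m₂ : ℕ) : ℝ) * Lf) * l1 (mulVecE (Abar Lf m₁ m₂ d) x) :=
    mul_nonneg (by positivity) (l1_nonneg _)
  linarith

theorem mulVecE_linear {ι κ : Type} [Fintype ι] [DecidableEq ι] (B : Matrix κ ι ℝ)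
    [Fintype κ] (x : EuclideanSpace ℝ ι) : mulVecE B x = Matrix.toEuclideanLin B x := rfl

theorem standingAssumption_hardInstance (hε : 0 < ε) (hLf : 0 < Lf) (hβ : 0 ≤ β)
    (hm : 0 < 3 * m₁ * m₂) (hd : Odd d) : (hardInstance ε Lf β m₁ m₂ d).StandingAssumption Lf := by
  have hk : 0 ≤ β / (((3 * m₁ * m₂ : ℕ) : ℝ) * Lf) := by positivity
  refine ⟨fun x => (hasGradientAt_f0 hε hLf hm hd x).differentiableAt, fun x x' => ?_,
    (EReal.bot_lt_coe _).trans_le (F0_lower hε hLf hβ hm hd), ?_, ?_⟩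
  · change ‖gradient (f0 ε Lf m₁ m₂ d) x - gradient (f0 ε Lf m₁ m₂ d) x'‖ ≤ _
    rw [gradient_f0 hε hLf hm hd]
    exact f0Grad_lipschitz hε hLf hm x x'
  · exact properLscConvex_coe (continuous_const.mul l1_continuous) (l1_convexOn.smul hk)
  · have hg : (hardInstance ε Lf β m₁ m₂ d).g = fun x => ((β / (((3 * m₁ * m₂ : ℕ) : ℝ) * Lf) *
        l1 (Matrix.toEuclideanLin (Abar Lf m₁ m₂ d) x) : ℝ) : EReal) :=
      funext fun x => by rw [g_eq, mulVecE_linear]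
    rw [hg]
    refine properLscConvex_coe (continuous_const.mul (l1_continuous.comp
      (LinearMap.continuous_of_finiteDimensional _))) ?_
    exact (l1_convexOn.comp_linearMap (Matrix.toEuclideanLin (Abar Lf m₁ m₂ d))).smul hk

theorem gap_le (hε : 0 < ε) (hLf : 0 < Lf) (hβ : 0 ≤ β) (hm : 0 < 3 * m₁ * m₂) (hd : Odd d) :
    (hardInstance ε Lf β m₁ m₂ d).gap 0 ≤ 1800 * Real.pi ^ 2 * ε ^ 2 * d / Lf := by
  have h1 := F0_lower (m₁ := m₁) (m₂ := m₂) hε hLf hβ hm hd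
  have h2 : (hardInstance ε Lf β m₁ m₂ d).F0 0 ≤ ((0 : ℝ) : EReal) := by
    rw [F0_eq, EReal.coe_le_coe_iff]
    have : l1 (mulVecE (Abar Lf m₁ m₂ d) 0) = 0 := by simp [mulVecE, l1]
    rw [this, mul_zero, add_zero]
    exact f0_zero_le hε hLf hd
  have h3 : (hardInstance ε Lf β m₁ m₂ d).F0 0 - ⨅ z, (hardInstance ε Lf β m₁ m₂ d).F0 z ≤
      ((1800 * Real.pi ^ 2 * ε ^ 2 * d / Lf : ℝ) : EReal) := by
    refine (EReal.sub_le_sub h2 h1).trans (le_of_eq ?_)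
    rw [← EReal.coe_sub]; simp
  have hpi := Real.pi_pos
  unfold CompositeProblem.gap
  -- `EReal.toReal` is monotone only away from the infinities. A nonnegative difference is not ⊥,
  -- and a nonpositive one has nonpositive real value.
  rcases le_total (0 : EReal)
    ((hardInstance ε Lf β m₁ m₂ d).F0 0 - ⨅ z, (hardInstance ε Lf β m₁ m₂ d).F0 z) with h | h
  · have := EReal.toReal_le_toReal h3 (fun hb => by rw [hb] at h; simp at h) (EReal.coe_ne_top _)
    simpa using this
  · exact (EReal.toReal_nonpos h).trans (by positivity)

end

end HardInstance

/-! ### Discrete Poincaré inequality and the joint condition number -/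

/-- Telescoping and Cauchy–Schwarz. It serves both the smallest eigenvalue of the stacked matrix and
the closeness of the blocks at stationary points. -/
theorem sq_sub_le_mul_sum_sq (v : ℕ → ℝ) {N a b : ℕ} (ha : a ≤ N) (hb : b ≤ N) :
    (v a - v b) ^ 2 ≤ N * ∑ l ∈ range N, (v (l + 1) - v l) ^ 2 := by
  wlog hab : b ≤ a generalizing a b
  · rw [← neg_sub, neg_sq]
    exact this hb ha (le_of_not_ge hab)
  rw [← sum_Ico_sub v hab]
  have h1 := sq_sum_le_card_mul_sum_sq (s := Ico b a) (f := fun l => v (l + 1) - v l)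
  have hsub : Ico b a ⊆ range N := fun l hl => by
    rw [mem_Ico] at hl; rw [mem_range]; omega
  refine h1.trans ?_
  gcongr
  rw [Nat.card_Ico]; omega

theorem sum_sq_diff_le {u : ℕ → ℝ} {m : ℕ} (h0 : u 0 = 0) (hm : u m = 0) :
    ∑ i ∈ range m, (u i - u (i + 1)) ^ 2 ≤ 4 * ∑ i ∈ range m, u i ^ 2 := by
  have h1 : ∑ i ∈ range m, u (i + 1) ^ 2 = ∑ i ∈ range m, u i ^ 2 := by
    have := sum_range_succ' (fun i => u i ^ 2) m
    rw [sum_range_succ, h0, hm] at this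
    simpa using this.symm
  calc _ ≤ ∑ i ∈ range m, (2 * u i ^ 2 + 2 * u (i + 1) ^ 2) :=
        sum_le_sum fun i _ => by nlinarith [sq_nonneg (u i + u (i + 1))]
    _ = _ := by rw [sum_add_distrib, ← mul_sum, ← mul_sum, h1]; ring

theorem sum_sq_le_sum_sq_diff {u : ℕ → ℝ} {m : ℕ} (h0 : u 0 = 0) :
    ∑ i ∈ range m, u i ^ 2 ≤ (m : ℝ) ^ 2 * ∑ i ∈ range m, (u i - u (i + 1)) ^ 2 := by
  calc _ ≤ ∑ i ∈ range m, (m : ℝ) * ∑ i ∈ range m, (u i - u (i + 1)) ^ 2 := by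
        refine sum_le_sum fun i hi => ?_
        have := sq_sub_le_mul_sum_sq u (mem_range.1 hi).le (Nat.zero_le m)
        rw [h0, sub_zero] at this
        refine this.trans (le_of_eq ?_)
        congr 1
        exact sum_congr rfl fun l _ => by ring
    _ = _ := by rw [sum_const, card_range, nsmul_eq_mul]; ring

/-- The two hypotheses bound the Rayleigh quotient of BBᵀ, hence every eigenvalue. -/
theorem condNumber_le {ι κ : Type} [Fintype ι] [Fintype κ] [DecidableEq κ] (B : Matrix κ ι ℝ)
    {a b : ℝ} (ha : 0 < a) (hb : 0 ≤ b)
    (hlow : ∀ w : κ → ℝ, a * ∑ k, w k ^ 2 ≤ ∑ i, (B.transpose.mulVec w) i ^ 2)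
    (hup : ∀ w : κ → ℝ, ∑ i, (B.transpose.mulVec w) i ^ 2 ≤ b * ∑ k, w k ^ 2) :
    condNumber B ≤ Real.sqrt (b / a) := by
  have key (μ : ℝ) (hμ : μ ∈ spectrum ℝ (B * B.transpose)) : a ≤ μ ∧ μ ≤ b := by
    rw [← Matrix.spectrum_toLin', ← Module.End.hasEigenvalue_iff_mem_spectrum] at hμ
    obtain ⟨w, hw⟩ := hμ.exists_hasEigenvector
    have h1 := hw.apply_eq_smul
    rw [Matrix.toLin'_apply, ← Matrix.mulVec_mulVec] at h1
    have h2 : ∑ i, (B.transpose.mulVec w) i ^ 2 = μ * ∑ k, w k ^ 2 := by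
      have h3 : w ⬝ᵥ B.mulVec (B.transpose.mulVec w) = w ⬝ᵥ (μ • w) := by rw [h1]
      rw [Matrix.dotProduct_mulVec, ← Matrix.mulVec_transpose, dotProduct_smul, smul_eq_mul] at h3
      simpa only [dotProduct, ← sq] using h3
    have h3 : 0 < ∑ k, w k ^ 2 := by
      obtain ⟨k, hk⟩ := Function.ne_iff.1 hw.2
      exact sum_pos' (fun _ _ => sq_nonneg _) ⟨k, mem_univ k, by have : w k ≠ 0 := hk; positivity⟩
    have h4 := hlow w
    have h5 := hup w
    rw [h2] at h4 h5
    exact ⟨le_of_mul_le_mul_right h4 h3, le_of_mul_le_mul_right h5 h3⟩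
  unfold condNumber
  apply Real.sqrt_le_sqrt
  have hsup : sSup (spectrum ℝ (B * B.transpose)) ≤ b := Real.sSup_le (fun μ hμ => (key μ hμ).2) hb
  rcases {μ : ℝ | μ ∈ spectrum ℝ (B * B.transpose) ∧ 0 < μ}.eq_empty_or_nonempty with h | h
  -- Without a positive eigenvalue the infimum is 0 by convention, and so is the quotient.
  · rw [h, Real.sInf_empty, div_zero]; positivity
  · exact div_le_div₀ hb hsup ha (le_csInf h fun μ hμ => (key μ hμ.1).1)

namespace HardInstance

section

variable {m₁ m₂ d : ℕ}

/-- The block preceding the `l`-th difference. -/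
def loIdx {m : ℕ} (l : Fin (m - 1)) : Fin m := ⟨l, by omega⟩

/-- The block following the `l`-th difference. -/
def hiIdx {m : ℕ} (l : Fin (m - 1)) : Fin m := ⟨l + 1, by omega⟩

theorem J_eq {m : ℕ} (l : Fin (m - 1)) (i : Fin m) :
    J m l i = (if i = hiIdx l then 1 else 0) - (if i = loIdx l then 1 else 0) := by
  unfold J hiIdx loIdx
  simp only [Fin.ext_iff]
  split_ifs <;> first | omega | norm_num

theorem sum_J_mul {m : ℕ} (l : Fin (m - 1)) (u : Fin m → ℝ) :
    ∑ i, J m l i * u i = u (hiIdx l) - u (loIdx l) := by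
  simp [J_eq, sub_mul, sum_sub_distrib]

theorem mulVecE_blockMatrix (Lf : ℝ) (S : Finset (Fin (3 * m₁ * m₂ - 1)))
    (x : EuclideanSpace ℝ (Fin (3 * m₁ * m₂) × Fin d)) (l : S) (c : Fin d) :
    mulVecE (blockMatrix Lf m₁ m₂ d S) x (l, c) =
      ((3 * m₁ * m₂ : ℕ) : ℝ) * Lf * (x (hiIdx l.1, c) - x (loIdx l.1, c)) := by
  rw [← sum_J_mul l.1 fun i => x (i, c), mul_sum]
  simp only [mulVecE, blockMatrix, Matrix.mulVec, dotProduct, Fintype.sum_prod_type,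
    Matrix.smul_apply, Matrix.kroneckerMap_apply, Matrix.submatrix_apply, Matrix.one_apply, id,
    smul_eq_mul]
  refine sum_congr rfl fun i _ => ?_
  rw [sum_eq_single c]
  · simp; ring
  · intro c' _ h; simp [h.symm]
  · simp

theorem blockMatrix_transpose_mulVec (Lf : ℝ) (S : Finset (Fin (3 * m₁ * m₂ - 1)))
    (w : S × Fin d → ℝ) (i : Fin (3 * m₁ * m₂)) (c : Fin d) :
    (blockMatrix Lf m₁ m₂ d S).transpose.mulVec w (i, c) =
      ((3 * m₁ * m₂ : ℕ) : ℝ) * Lf * ∑ l : S, J (3 * m₁ * m₂) l.1 i * w (l, c) := by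
  rw [mul_sum]
  simp only [blockMatrix, Matrix.mulVec, dotProduct, Fintype.sum_prod_type,
    Matrix.smul_apply, Matrix.kroneckerMap_apply, Matrix.submatrix_apply, Matrix.one_apply, id,
    smul_eq_mul, Matrix.transpose_apply]
  refine sum_congr rfl fun l _ => ?_
  rw [sum_eq_single c]
  · simp; ring
  · intro c' _ h; simp [h]
  · simp

/-- The sequence `0, U₀, U₁, …, U_{m-2}, 0, 0, …`. -/
noncomputable def padSeq {m : ℕ} (U : Fin (m - 1) → ℝ) : ℕ → ℝ
  | 0 => 0
  | k + 1 => if h : k < m - 1 then U ⟨k, h⟩ else 0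

theorem sum_mul_J {m : ℕ} (U : Fin (m - 1) → ℝ) (i : Fin m) :
    ∑ l, J m l i * U l = padSeq U i - padSeq U (i + 1) := by
  simp only [J_eq, sub_mul, sum_sub_distrib]
  congr 1
  · rcases i with ⟨_ | k, hk⟩
    · simp only [padSeq, hiIdx, Fin.mk.injEq]
      exact sum_eq_zero fun l _ => by simp
    · have hk' : k < m - 1 := by omega
      simp only [padSeq, hk', dif_pos]
      rw [sum_eq_single ⟨k, hk'⟩]
      · simp [hiIdx]
      · intro l _ hl
        have : (l : ℕ) ≠ k := fun h => hl (Fin.ext h)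
        simp [hiIdx, this.symm]
      · simp
  · simp only [padSeq]
    split_ifs with h
    · rw [sum_eq_single ⟨i, h⟩]
      · simp [loIdx]
      · intro l _ hl
        have : (l : ℕ) ≠ i := fun h => hl (Fin.ext h)
        simp [loIdx, Fin.ext_iff, this.symm]
      · simp
    · refine sum_eq_zero fun l _ => ?_
      have := l.2
      have : (i : ℕ) ≠ l := by omega
      simp [loIdx, Fin.ext_iff, this]

theorem sum_sq_eq_padSeq {m : ℕ} (hm : 0 < m) (U : Fin (m - 1) → ℝ) :
    ∑ l, U l ^ 2 = ∑ i ∈ range m, padSeq U i ^ 2 := by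
  obtain ⟨k, rfl⟩ : ∃ k, m = k + 1 := ⟨m - 1, by omega⟩
  rw [sum_range_succ', sum_range]
  simp [padSeq]

/-- Up to the order of rows, the stacked matrix is m L_f · J_m ⊗ I; `W` undoes the splitting of the
rows. -/
theorem sum_fromRows (Lf : ℝ) (S : Finset (Fin (3 * m₁ * m₂ - 1)))
    (w : (S × Fin d) ⊕ ((Sᶜ : Finset _) × Fin d) → ℝ) :
    ∃ W : Fin (3 * m₁ * m₂ - 1) → Fin d → ℝ, ∑ k, w k ^ 2 = ∑ c, ∑ l, W l c ^ 2 ∧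
      ∀ i c, (Matrix.fromRows (blockMatrix Lf m₁ m₂ d S) (blockMatrix Lf m₁ m₂ d Sᶜ)).transpose.mulVec
        w (i, c) = ((3 * m₁ * m₂ : ℕ) : ℝ) * Lf * ∑ l, J (3 * m₁ * m₂) l i * W l c := by
  let W : Fin (3 * m₁ * m₂ - 1) → Fin d → ℝ := fun l c =>
    if h : l ∈ S then w (Sum.inl (⟨l, h⟩, c)) else w (Sum.inr (⟨l, mem_compl.2 h⟩, c))
  have h1 (l : S) (c : Fin d) : w (Sum.inl (l, c)) = W l c := by simp [W]
  have h2 (l : (Sᶜ : Finset _)) (c : Fin d) : w (Sum.inr (l, c)) = W l c := by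
    have := mem_compl.1 l.2
    simp [W, this]
  have hsplit (F : Fin (3 * m₁ * m₂ - 1) → ℝ) :
      ∑ l : S, F l + ∑ l : (Sᶜ : Finset _), F l = ∑ l, F l := by
    rw [sum_coe_sort S F, sum_coe_sort Sᶜ F, sum_add_sum_compl]
  refine ⟨W, ?_, fun i c => ?_⟩
  · rw [Fintype.sum_sum_type, Fintype.sum_prod_type_right, Fintype.sum_prod_type_right,
      ← sum_add_distrib]
    refine sum_congr rfl fun c _ => ?_
    simp only [h1, h2]
    exact hsplit fun l => W l c ^ 2
  · rw [Matrix.transpose_fromRows, Matrix.fromCols_mulVec, Pi.add_apply,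
      blockMatrix_transpose_mulVec, blockMatrix_transpose_mulVec, ← mul_add]
    congr 1
    simp only [Function.comp, h1, h2]
    exact hsplit fun l => J (3 * m₁ * m₂) l i * W l c

/-- On each coordinate, Jᵀ takes differences of a sequence with zero boundary values. Hence J Jᵀ has
its spectrum in [1/m², 4], and BBᵀ has its spectrum in [L_f², 4m²L_f²]. -/
theorem jointCond_le {ε Lf β : ℝ} (hLf : 0 < Lf) (hm : 0 < 3 * m₁ * m₂) :
    (hardInstance ε Lf β m₁ m₂ d).jointCond ≤ 2 * ((3 * m₁ * m₂ : ℕ) : ℝ) := by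
  have hm' : (0 : ℝ) < (3 * m₁ * m₂ : ℕ) := by exact_mod_cast hm
  have hsq : Real.sqrt ((4 * (((3 * m₁ * m₂ : ℕ) : ℝ) * Lf) ^ 2) / Lf ^ 2) =
      2 * ((3 * m₁ * m₂ : ℕ) : ℝ) := by
    rw [← Real.sqrt_sq (by positivity : 0 ≤ 2 * ((3 * m₁ * m₂ : ℕ) : ℝ))]
    congr 1
    field_simp
    norm_num
  rw [← hsq]
  have hpad (U : Fin (3 * m₁ * m₂ - 1) → ℝ) : padSeq U (3 * m₁ * m₂) = 0 := by
    obtain ⟨k, hk⟩ : ∃ k, 3 * m₁ * m₂ = k + 1 := ⟨3 * m₁ * m₂ - 1, by omega⟩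
    generalize 3 * m₁ * m₂ = m at *
    subst hk
    simp [padSeq]
  refine condNumber_le _ (by positivity) (by positivity) (fun w => ?_) (fun w => ?_)
  all_goals
    obtain ⟨W, hW1, hW2⟩ := sum_fromRows Lf (rowSet m₁ m₂) w
    have hB : ∀ i c, (Matrix.fromRows (hardInstance ε Lf β m₁ m₂ d).Abar
      (hardInstance ε Lf β m₁ m₂ d).A).transpose.mulVec w (i, c) = _ := hW2
    rw [hW1, Fintype.sum_prod_type_right, mul_sum]
    refine sum_le_sum fun c _ => ?_
    simp only [hB, sum_mul_J, mul_pow, ← mul_sum]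
    rw [sum_sq_eq_padSeq hm,
      ← sum_range fun i => (padSeq (fun l => W l c) i - padSeq (fun l => W l c) (i + 1)) ^ 2]
  · have := sum_sq_le_sum_sq_diff (u := padSeq fun l => W l c) (m := 3 * m₁ * m₂) rfl
    nlinarith [sq_nonneg Lf]
  · have := sum_sq_diff_le (u := padSeq fun l => W l c) (m := 3 * m₁ * m₂) rfl (hpad _)
    have h2 : 0 ≤ ((3 * m₁ * m₂ : ℕ) : ℝ) ^ 2 * Lf ^ 2 := by positivity
    nlinarith

end

end HardInstance

/-! ### Speed of propagation of the support -/

/-- The vectors whose coordinate `p` vanishes as long as `t < T p`. -/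
def arrivalSubmodule {ι : Type} (T : ι → ℕ) (t : ℕ) : Submodule ℝ (EuclideanSpace ℝ ι) where
  carrier := {x | ∀ p, t < T p → x p = 0}
  zero_mem' := fun p _ => rfl
  add_mem' := fun {x y} hx hy p hp => by simp [hx p hp, hy p hp]
  smul_mem' := fun a x hx p hp => by simp [hx p hp]

theorem arrivalSubmodule_mono {ι : Type} (T : ι → ℕ) {s t : ℕ} (h : s ≤ t) :
    arrivalSubmodule T s ≤ arrivalSubmodule T t := fun _ hx p hp => hx p (h.trans_lt hp)

namespace HardInstance

/-- A lower bound for the iteration at which coordinate `c` of block `i` can become nonzero. -/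
def arrival (M i c : ℕ) : ℕ :=
  if c = 0 then 0 else if c % 2 = 1 then (c - 1) * M + (i + 1 - M) else (c - 1) * M + (2 * M - i)

/-- For fixed c > 0 the profile is flat on the third where coordinate c is switched on and rises by
one per block away from it; truncated subtraction produces the flat part. -/
theorem arrival_le_succ (M i c : ℕ) : arrival M i c ≤ arrival M (i + 1) c + 1 := by
  unfold arrival
  split_ifs <;> omega

theorem arrival_succ_le (M i c : ℕ) : arrival M (i + 1) c ≤ arrival M i c + 1 := by
  unfold arrival
  split_ifs <;> omega

/-- Coordinate c starts in one outer third and needs about M more iterations to reach the opposite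
one, where the link to c + 1 is active. The base value of c + 1 exceeds that of c by M, which
matches this delay. -/
theorem arrival_of_weight_ne_zero {M d i c : ℕ} (h : weight M d i c ≠ 0) :
    arrival M i (c + 1) ≤ arrival M i c + 1 := by
  have h' : c + 1 < d ∧ ((i < M ∧ Even c) ∨ (2 * M ≤ i ∧ Odd c)) := by
    by_contra hc; exact h (if_neg hc)
  have hmul (k : ℕ) : (k + 1) * M = k * M + M := by ring
  obtain ⟨-, ⟨hi, hc⟩ | ⟨hi, hc⟩⟩ := h'
  · rw [Nat.even_iff] at hc
    rcases c with _ | c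
    · simp [arrival]; omega
    · have h1 : (c + 1 + 1) % 2 = 1 := by omega
      simp only [arrival, Nat.add_sub_cancel, h1, hc, hmul]
      simp; omega
  · rw [Nat.odd_iff] at hc
    rcases c with _ | c
    · omega
    · have h1 : ¬ (c + 1 + 1) % 2 = 1 := by omega
      simp only [arrival, Nat.add_sub_cancel, h1, hc, hmul]
      simp; omega

section

variable {ε Lf β : ℝ} {m₁ m₂ d : ℕ}

/-- The vectors supported on the coordinates that can be reached in `t` iterations. -/
def primalSpace (m₁ m₂ d t : ℕ) : Submodule ℝ (EuclideanSpace ℝ (Fin (3 * m₁ * m₂) × Fin d)) :=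
  arrivalSubmodule (fun p => arrival (m₁ * m₂) p.1 p.2) t

/-- The vectors of differences supported on the coordinates that can be reached in `t`
iterations. -/
def dualSpace (m₁ m₂ d : ℕ) (S : Finset (Fin (3 * m₁ * m₂ - 1))) (t : ℕ) :
    Submodule ℝ (EuclideanSpace ℝ (S × Fin d)) :=
  arrivalSubmodule (fun p => min (arrival (m₁ * m₂) p.1.1 p.2) (arrival (m₁ * m₂) (p.1.1 + 1) p.2)) t

theorem mulVecE_blockMatrix_mem {S : Finset (Fin (3 * m₁ * m₂ - 1))} {t : ℕ}
    {x : EuclideanSpace ℝ (Fin (3 * m₁ * m₂) × Fin d)} (hx : x ∈ primalSpace m₁ m₂ d t) :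
    mulVecE (blockMatrix Lf m₁ m₂ d S) x ∈ dualSpace m₁ m₂ d S t := by
  rintro ⟨l, c⟩ hp
  rw [lt_min_iff] at hp
  rw [mulVecE_blockMatrix, hx (hiIdx l.1, c) hp.2, hx (loIdx l.1, c) hp.1]
  simp

/-- A difference is reached with the earlier of its two blocks. Passing back to the other block
costs one iteration, since neighbouring arrival times differ by at most one. -/
theorem mulVecE_blockMatrix_transpose_mem {S : Finset (Fin (3 * m₁ * m₂ - 1))} {t : ℕ}
    {y : EuclideanSpace ℝ (S × Fin d)} (hy : y ∈ dualSpace m₁ m₂ d S t) :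
    mulVecE (blockMatrix Lf m₁ m₂ d S).transpose y ∈ primalSpace m₁ m₂ d (t + 1) := by
  rintro ⟨i, c⟩ hp
  change (blockMatrix Lf m₁ m₂ d S).transpose.mulVec y.ofLp (i, c) = 0
  change t + 1 < arrival (m₁ * m₂) i c at hp
  rw [blockMatrix_transpose_mulVec, sum_eq_zero, mul_zero]
  intro l _
  have h1 := arrival_le_succ (m₁ * m₂) l.1 c
  have h2 := arrival_succ_le (m₁ * m₂) l.1 c
  have hmin (h3 : t < arrival (m₁ * m₂) l.1 c) (h4 : t < arrival (m₁ * m₂) (l.1 + 1) c) :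
      t < min (arrival (m₁ * m₂) l.1 c) (arrival (m₁ * m₂) (l.1 + 1) c) := lt_min h3 h4
  by_cases hhi : i = hiIdx l.1
  · have hi : (i : ℕ) = l.1 + 1 := by rw [hhi]; rfl
    rw [hi] at hp
    have : y (l, c) = 0 := hy (l, c) (hmin (by omega) (by omega))
    rw [this, mul_zero]
  · by_cases hlo : i = loIdx l.1
    · have hi : (i : ℕ) = l.1 := by rw [hlo]; rfl
      rw [hi] at hp
      have : y (l, c) = 0 := hy (l, c) (hmin (by omega) (by omega))
      rw [this, mul_zero]
    · rw [J_eq, if_neg hhi, if_neg hlo]; simp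

/-- At an unreached coordinate only the incoming link could contribute; if it is present, its first
coordinate is still zero one iteration earlier. -/
theorem f0Grad_mem {t : ℕ} {x : EuclideanSpace ℝ (Fin (3 * m₁ * m₂) × Fin d)}
    (hx : x ∈ primalSpace m₁ m₂ d t) : f0Grad ε Lf x ∈ primalSpace m₁ m₂ d (t + 1) := by
  rintro ⟨i, c⟩ hp
  change t + 1 < arrival (m₁ * m₂) i c at hp
  have hz (c : ℕ) (h : t < arrival (m₁ * m₂) i c) : scaledSeq ε Lf x i c = 0 := by
    unfold scaledSeq
    by_cases hc : c < d
    · have h1 := blockSeq_coe x i ⟨c, hc⟩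
      rw [hx (i, ⟨c, hc⟩) h] at h1
      change blockSeq x i c = 0 at h1
      rw [h1, mul_zero]
    · simp [blockSeq, coord, hc]
  simp only [f0Grad]
  obtain ⟨c, hc⟩ := c
  rcases c with _ | c
  · simp [arrival] at hp
  · simp only [chainGrad]
    rw [hz (c + 1) (by simpa using (Nat.lt_succ_self t).trans hp), pairFunU_zero, mul_zero, add_zero]
    by_cases hw : weight (m₁ * m₂) d i c = 0
    · rw [hw]; simp
    · have := arrival_of_weight_ne_zero hw
      rw [hz c (by simp only at hp; omega), pairFunV_zero]; simp

/-- Where ξ vanishes, resetting that coordinate of ζ to zero does not raise the ℓ¹ norm and strictly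
lowers the distance to ξ if the coordinate was nonzero. -/
theorem prox_gbar_mem {t : ℕ} {η : ℝ} (hη : 0 < η) (hβ : 0 ≤ β) (hLf : 0 < Lf)
    {ξ ζ : EuclideanSpace ℝ (rowSet m₁ m₂ × Fin d)}
    (hprox : IsProx (gbar Lf β m₁ m₂ d) η ξ ζ) (hξ : ξ ∈ dualSpace m₁ m₂ d (rowSet m₁ m₂) t) :
    ζ ∈ dualSpace m₁ m₂ d (rowSet m₁ m₂) t := by
  classical
  intro p hp
  by_contra hne
  have hξp : ξ p = 0 := hξ p hp
  set z : EuclideanSpace ℝ (rowSet m₁ m₂ × Fin d) :=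
    WithLp.toLp 2 (Function.update ζ.ofLp p 0) with hz
  have hzp : z p = 0 := by simp [hz]
  have hzq (q) (hq : q ≠ p) : z q = ζ q := by simp [hz, hq]
  have h := hprox z
  rw [gbar_eq, gbar_eq, ← EReal.coe_add, ← EReal.coe_add, EReal.coe_le_coe_iff] at h
  have hl1 : l1 z ≤ l1 ζ := by
    refine sum_le_sum fun q _ => ?_
    by_cases hq : q = p
    · rw [hq, hzp, abs_zero]; exact abs_nonneg _
    · rw [hzq q hq]
  have hn : ‖z - ξ‖ ^ 2 < ‖ζ - ξ‖ ^ 2 := by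
    rw [EuclideanSpace.norm_sq_eq, EuclideanSpace.norm_sq_eq]
    refine sum_lt_sum (fun q _ => ?_) ⟨p, mem_univ p, ?_⟩
    · by_cases hq : q = p
      · rw [hq]; simp [hzp, hξp, sq_nonneg]
      · simp [hzq q hq]
    · simpa [hzp, hξp, sq_pos_iff] using hne
  have h1 : β / (((3 * m₁ * m₂ : ℕ) : ℝ) * Lf) * l1 z ≤ β / (((3 * m₁ * m₂ : ℕ) : ℝ) * Lf) * l1 ζ :=
    mul_le_mul_of_nonneg_left hl1 (by positivity)
  have h2 : 1 / (2 * η) * ‖z - ξ‖ ^ 2 < 1 / (2 * η) * ‖ζ - ξ‖ ^ 2 :=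
    mul_lt_mul_of_pos_left hn (by positivity)
  linarith

theorem iterates_mem (hε : 0 < ε) (hLf : 0 < Lf) (hβ : 0 ≤ β) (hm : 0 < 3 * m₁ * m₂) (hd : Odd d)
    {x : ℕ → EuclideanSpace ℝ (Fin (3 * m₁ * m₂) × Fin d)}
    {y : ℕ → EuclideanSpace ℝ (rowSet m₁ m₂ × Fin d)} (hx0 : x 0 = 0) (hy0 : y 0 = 0)
    (hxy : (hardInstance ε Lf β m₁ m₂ d).SplittingSpan x y) (t : ℕ) :
    x t ∈ primalSpace m₁ m₂ d t ∧ y t ∈ dualSpace m₁ m₂ d (rowSet m₁ m₂) t := by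
  induction t using Nat.strong_induction_on with
  | _ t ih =>
    rcases Nat.eq_zero_or_pos t with rfl | ht
    · rw [hx0, hy0]; exact ⟨zero_mem _, zero_mem _⟩
    obtain ⟨hx, ξ, hξ, η, hη, ζ, hζ, hy⟩ := hxy t ht
    have hmono {s : ℕ} (hs : s < t) {v} (hv : v ∈ primalSpace m₁ m₂ d (s + 1)) :
        v ∈ primalSpace m₁ m₂ d t := arrivalSubmodule_mono _ hs hv
    have hξ' : ξ ∈ dualSpace m₁ m₂ d (rowSet m₁ m₂) t := by
      refine (Submodule.span_le.2 ?_) hξ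
      rintro v (hv | hv)
      · rw [Set.mem_singleton_iff.1 hv]; exact zero_mem _
      · simp only [Set.mem_iUnion] at hv
        obtain ⟨s, hs, rfl | rfl | rfl⟩ := hv
        · exact arrivalSubmodule_mono _ hs.le (ih s hs).2
        · exact mulVecE_blockMatrix_mem (hmono hs (mulVecE_blockMatrix_transpose_mem (ih s hs).2))
        · exact arrivalSubmodule_mono _ hs.le (mulVecE_blockMatrix_mem (ih s hs).1)
    refine ⟨(Submodule.span_le.2 ?_) hx, (Submodule.span_le.2 ?_) hy⟩
    · rintro v (hv | hv)
      · have h0 {κ : Type} [Fintype κ] (B : Matrix (Fin (3 * m₁ * m₂) × Fin d) κ ℝ) :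
            mulVecE B 0 = 0 := by simp [mulVecE]
        rcases hv with rfl | rfl
        · exact (congrArg (· ∈ primalSpace m₁ m₂ d t) (h0 (A Lf m₁ m₂ d).transpose)).mpr (zero_mem _)
        · exact (congrArg (· ∈ primalSpace m₁ m₂ d t) (h0 (Abar Lf m₁ m₂ d).transpose)).mpr (zero_mem _)
      · simp only [Set.mem_iUnion] at hv
        obtain ⟨s, hs, rfl | rfl | rfl | rfl | rfl⟩ := hv
        · exact arrivalSubmodule_mono _ hs.le (ih s hs).1
        · change gradient (f0 ε Lf m₁ m₂ d) (x s) ∈ _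
          rw [gradient_f0 hε hLf hm hd]
          exact hmono hs (f0Grad_mem (ih s hs).1)
        · exact hmono hs (mulVecE_blockMatrix_transpose_mem (mulVecE_blockMatrix_mem (ih s hs).1))
        · exact hmono hs (mulVecE_blockMatrix_transpose_mem (mulVecE_blockMatrix_mem (ih s hs).1))
        · exact hmono hs (mulVecE_blockMatrix_transpose_mem (ih s hs).2)
    · rintro v (rfl | rfl)
      · exact hξ'
      · exact prox_gbar_mem hη hβ hLf hζ hξ'

theorem last_coord_eq_zero (hε : 0 < ε) (hLf : 0 < Lf) (hβ : 0 ≤ β) (hm : 0 < 3 * m₁ * m₂)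
    (hd : Odd d) (hd5 : 5 ≤ d) {x : ℕ → EuclideanSpace ℝ (Fin (3 * m₁ * m₂) × Fin d)}
    {y : ℕ → EuclideanSpace ℝ (rowSet m₁ m₂ × Fin d)} (hx0 : x 0 = 0) (hy0 : y 0 = 0)
    (hxy : (hardInstance ε Lf β m₁ m₂ d).SplittingSpan x y) {t : ℕ} (ht : t < (d - 2) * (m₁ * m₂))
    (i : Fin (3 * m₁ * m₂)) : x t (i, ⟨d - 1, by omega⟩) = 0 := by
  refine (iterates_mem hε hLf hβ hm hd hx0 hy0 hxy t).1 _ (ht.trans_le ?_)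
  have h1 := Nat.odd_iff.1 hd
  simp only [arrival]
  -- The last 0-based index d - 1 is positive and even, so the even branch applies, with base value
  -- (d - 2)M.
  rw [if_neg (by omega), if_neg (by omega), show d - 1 - 1 = d - 2 by omega]
  omega

end

end HardInstance

/-! ### Stationary points -/

theorem mulVecE_add {ι κ : Type} [Fintype ι] (B : Matrix κ ι ℝ) (x y : EuclideanSpace ℝ ι) :
    mulVecE B (x + y) = mulVecE B x + mulVecE B y := by
  ext k; simp [mulVecE, Matrix.mulVec_add]

theorem inner_mulVecE_transpose {ι κ : Type} [Fintype ι] [Fintype κ] (B : Matrix κ ι ℝ)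
    (y : EuclideanSpace ℝ κ) (x : EuclideanSpace ℝ ι) :
    inner ℝ (mulVecE B.transpose y) x = inner ℝ y (mulVecE B x) := by
  simp only [EuclideanSpace.inner_eq_star_dotProduct, mulVecE, star_trivial]
  rw [Matrix.mulVec_transpose, dotProduct_comm, ← Matrix.dotProduct_mulVec, dotProduct_comm]

namespace HardInstance

section

variable {ε Lf β : ℝ} {m₁ m₂ d : ℕ}

/-- For v in ker A the term Aᵀγ is orthogonal to v, and the subgradient inequality replaces ⟨ξ, v⟩
by a difference of values of g. -/
theorem stationary_test (hε : 0 < ε) (hLf : 0 < Lf) (hm : 0 < 3 * m₁ * m₂) (hd : Odd d)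
    {xs : EuclideanSpace ℝ (Fin (3 * m₁ * m₂) × Fin d)}
    (hst : (hardInstance ε Lf β m₁ m₂ d).IsStationary ε xs)
    {v : EuclideanSpace ℝ (Fin (3 * m₁ * m₂) × Fin d)} (hv : mulVecE (A Lf m₁ m₂ d) v = 0) :
    -(6 / 5 * ε * ‖v‖) ≤ inner ℝ (f0Grad ε Lf xs) v + β / (((3 * m₁ * m₂ : ℕ) : ℝ) * Lf) *
      (l1 (mulVecE (Abar Lf m₁ m₂ d) (xs + v)) - l1 (mulVecE (Abar Lf m₁ m₂ d) xs)) := by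
  obtain ⟨γ, hdist, -⟩ := hst
  -- The distance bound ε need not be attained by an element; the factor 6/5 leaves room to pick
  -- one.
  have hlt : ENNReal.ofReal ε < ENNReal.ofReal (6 / 5 * ε) :=
    (ENNReal.ofReal_lt_ofReal_iff (by positivity)).2 (by linarith)
  obtain ⟨u, ⟨ξ, hξ, rfl⟩, hu⟩ := Metric.infEDist_lt_iff.1 (hdist.trans_lt hlt)
  change edist 0 (gradient (f0 ε Lf m₁ m₂ d) xs + mulVecE (A Lf m₁ m₂ d).transpose γ + ξ) < _ at hu
  rw [gradient_f0 hε hLf hm hd, edist_dist, ENNReal.ofReal_lt_ofReal_iff (by positivity),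
    dist_zero_left] at hu
  have h1 := hξ.2 (xs + v)
  rw [g_eq, g_eq, ← EReal.coe_add, EReal.coe_le_coe_iff, add_sub_cancel_left] at h1
  have h2 := neg_le_of_abs_le (abs_real_inner_le_norm
    (f0Grad ε Lf xs + mulVecE (A Lf m₁ m₂ d).transpose γ + ξ) v)
  rw [inner_add_left, inner_add_left, inner_mulVecE_transpose, hv, inner_zero_right] at h2
  have h3 := mul_le_mul_of_nonneg_right hu.le (norm_nonneg v)
  linarith

/-- The vector whose `c`-th coordinate is `α` in all blocks from the `n`-th on, and which vanishes
elsewhere. -/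
noncomputable def stepVec (m : ℕ) {d : ℕ} (n : ℕ) (c : Fin d) (α : ℝ) :
    EuclideanSpace ℝ (Fin m × Fin d) :=
  WithLp.toLp 2 fun p => if p.2 = c then if n ≤ p.1 then α else 0 else 0

theorem inner_stepVec {m : ℕ} (n : ℕ) (c : Fin d) (α : ℝ) (u : EuclideanSpace ℝ (Fin m × Fin d)) :
    inner ℝ u (stepVec m n c α) = ∑ i : Fin m, if n ≤ i then α * u (i, c) else 0 := by
  rw [PiLp.inner_apply, Fintype.sum_prod_type]
  refine sum_congr rfl fun i _ => ?_
  rw [sum_eq_single c]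
  · simp [stepVec]
  · intro c' _ h; simp [stepVec, h]
  · simp

theorem norm_stepVec_le {m : ℕ} (n : ℕ) (c : Fin d) (α : ℝ) :
    ‖stepVec m n c α‖ ≤ |α| * Real.sqrt m := by
  refine (sq_le_sq₀ (norm_nonneg _) (by positivity)).1 ?_
  rw [mul_pow, sq_abs, Real.sq_sqrt (Nat.cast_nonneg m), ← real_inner_self_eq_norm_sq, inner_stepVec]
  calc _ ≤ ∑ i : Fin m, α ^ 2 := by
        refine sum_le_sum fun i _ => ?_
        split_ifs with h
        · simp [stepVec, h, sq]
        · positivity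
    _ = _ := by simp [mul_comm]

theorem mulVecE_stepVec (S : Finset (Fin (3 * m₁ * m₂ - 1))) (n : ℕ) (c : Fin d) (α : ℝ) (l : S)
    (c' : Fin d) : mulVecE (blockMatrix Lf m₁ m₂ d S) (stepVec (3 * m₁ * m₂) n c α) (l, c') =
      if c' = c ∧ (l.1 : ℕ) + 1 = n then ((3 * m₁ * m₂ : ℕ) : ℝ) * Lf * α else 0 := by
  rw [mulVecE_blockMatrix]
  simp only [stepVec, hiIdx, loIdx]
  split_ifs <;> first | omega | simp

theorem abs_f0Grad_le (hε : 0 < ε) (x : EuclideanSpace ℝ (Fin (3 * m₁ * m₂) × Fin d)) (p) :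
    |f0Grad ε Lf x p| ≤ 2 * ε / Real.sqrt (3 * m₁ * m₂ : ℕ) * (16 + 12 * Real.pi) := by
  simp only [f0Grad]
  rw [abs_mul, abs_of_nonneg (by positivity)]
  gcongr
  exact abs_chainGrad_le (weight_nonneg _ _ _) (weight_le _ _ _) _ _

/-- Shifting all blocks after row l by α cancels the single entry a of Āx. This lowers g by β|α|,
while the gradient and the stationarity error offset at most (32 + 24π + 6/5)√m ε|α|, which is less.
-/
theorem Abar_eq_zero_of_stationary (hε : 0 < ε) (hLf : 0 < Lf) (hm : 0 < 3 * m₁ * m₂) (hd : Odd d)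
    (hβ : (50 * Real.pi + 1) * Real.sqrt ((3 * m₁ * m₂ : ℕ) : ℝ) * ε < β)
    {xs : EuclideanSpace ℝ (Fin (3 * m₁ * m₂) × Fin d)}
    (hst : (hardInstance ε Lf β m₁ m₂ d).IsStationary ε xs) (l : rowSet m₁ m₂) (c : Fin d) :
    mulVecE (Abar Lf m₁ m₂ d) xs (l, c) = 0 := by
  by_contra hne
  set a := mulVecE (Abar Lf m₁ m₂ d) xs (l, c) with ha
  have hm' : (0 : ℝ) < (3 * m₁ * m₂ : ℕ) := by exact_mod_cast hm
  have hK : 0 < ((3 * m₁ * m₂ : ℕ) : ℝ) * Lf := by positivity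
  have hs : 0 < Real.sqrt (3 * m₁ * m₂ : ℕ) := Real.sqrt_pos.2 hm'
  set α := -a / (((3 * m₁ * m₂ : ℕ) : ℝ) * Lf) with hα
  have hα0 : 0 < |α| := abs_pos.2 (div_ne_zero (neg_ne_zero.2 hne) hK.ne')
  have hKα : ((3 * m₁ * m₂ : ℕ) : ℝ) * Lf * α = -a := by rw [hα]; field_simp
  have hKα' : |a| = ((3 * m₁ * m₂ : ℕ) : ℝ) * Lf * |α| := by
    rw [← abs_neg, ← hKα, abs_mul, abs_of_pos hK]
  -- The only jump of the step is across row l, which belongs to 𝓜, so no row of A sees it.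
  have hv : mulVecE (A Lf m₁ m₂ d) (stepVec (3 * m₁ * m₂) (l.1 + 1) c α) = 0 := by
    ext ⟨l', c'⟩
    unfold A
    rw [mulVecE_stepVec, if_neg]
    · rfl
    · rintro ⟨-, h⟩
      have : l'.1 = l.1 := Fin.ext (by omega)
      exact mem_compl.1 l'.2 (this ▸ l.2)
  have h := stationary_test hε hLf hm hd hst hv
  have hl1 : l1 (mulVecE (Abar Lf m₁ m₂ d) (xs + stepVec (3 * m₁ * m₂) (l.1 + 1) c α)) -
      l1 (mulVecE (Abar Lf m₁ m₂ d) xs) = -|a| := by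
    unfold l1
    rw [← sum_sub_distrib, sum_eq_single (l, c)]
    · rw [mulVecE_add, PiLp.add_apply]
      unfold Abar at *
      rw [mulVecE_stepVec, if_pos ⟨rfl, rfl⟩, hKα, ← ha]
      simp
    · rintro ⟨l', c'⟩ _ hp
      rw [mulVecE_add, PiLp.add_apply]
      unfold Abar
      rw [mulVecE_stepVec, if_neg]
      · simp
      · rintro ⟨h1, h2⟩
        exact hp (Prod.ext (Subtype.ext (Fin.ext (by simpa using h2))) h1)
    · simp
  rw [hl1, inner_stepVec] at h
  have hsum : ∑ i : Fin (3 * m₁ * m₂), (if (l.1 : ℕ) + 1 ≤ i then α * f0Grad ε Lf xs (i, c) else 0) ≤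
      ∑ i : Fin (3 * m₁ * m₂), |α| * (2 * ε / Real.sqrt (3 * m₁ * m₂ : ℕ) * (16 + 12 * Real.pi)) := by
    have hpi := Real.pi_pos
    refine sum_le_sum fun i _ => ?_
    split_ifs
    · refine (le_abs_self _).trans ?_
      rw [abs_mul]
      exact mul_le_mul_of_nonneg_left (abs_f0Grad_le hε _ _) hα0.le
    · positivity
  rw [sum_const, card_univ, Fintype.card_fin, nsmul_eq_mul] at hsum
  have e1 : ((3 * m₁ * m₂ : ℕ) : ℝ) * (|α| * (2 * ε / Real.sqrt (3 * m₁ * m₂ : ℕ) *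
      (16 + 12 * Real.pi))) = |α| * (Real.sqrt (3 * m₁ * m₂ : ℕ) * ε * (32 + 24 * Real.pi)) := by
    field_simp
    rw [Real.sq_sqrt hm'.le]
    ring
  have e2 : β / (((3 * m₁ * m₂ : ℕ) : ℝ) * Lf) * -|a| = |α| * (-β) := by
    rw [hKα']; field_simp
  have hn := norm_stepVec_le (m := 3 * m₁ * m₂) (l.1 + 1) c α
  have hn' := mul_le_mul_of_nonneg_left hn (by positivity : 0 ≤ 6 / 5 * ε)
  rw [e1] at hsum
  rw [e2] at h
  have hfin : |α| * β ≤ |α| * (Real.sqrt (3 * m₁ * m₂ : ℕ) * ε * (32 + 24 * Real.pi + 6 / 5)) := by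
    linarith
  have hfin := le_of_mul_le_mul_left hfin hα0
  have hpi := Real.pi_gt_three
  have := mul_lt_mul_of_pos_left (by linarith : 32 + 24 * Real.pi + 6 / 5 < 50 * Real.pi + 1)
    (mul_pos hs hε)
  linarith

/-- Differences across rows of Ā vanish, those across rows of A have total square at most
(ε/(mL_f))², and fewer than m of them separate two blocks. -/
theorem blocks_close_of_stationary (hε : 0 < ε) (hLf : 0 < Lf) (hm : 0 < 3 * m₁ * m₂) (hd : Odd d)
    (hβ : (50 * Real.pi + 1) * Real.sqrt ((3 * m₁ * m₂ : ℕ) : ℝ) * ε < β)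
    {xs : EuclideanSpace ℝ (Fin (3 * m₁ * m₂) × Fin d)}
    (hst : (hardInstance ε Lf β m₁ m₂ d).IsStationary ε xs) (i i' : Fin (3 * m₁ * m₂)) (c : Fin d) :
    (xs (i, c) - xs (i', c)) ^ 2 ≤
      ((3 * m₁ * m₂ : ℕ) : ℝ) * (ε / (((3 * m₁ * m₂ : ℕ) : ℝ) * Lf)) ^ 2 := by
  have hm' : (0 : ℝ) < (3 * m₁ * m₂ : ℕ) := by exact_mod_cast hm
  have hK : 0 < ((3 * m₁ * m₂ : ℕ) : ℝ) * Lf := by positivity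
  have hA : ‖mulVecE (A Lf m₁ m₂ d) xs‖ ≤ ε := by
    obtain ⟨γ, -, h⟩ := hst
    change ‖mulVecE (A Lf m₁ m₂ d) xs + 0‖ ≤ ε at h
    rwa [add_zero] at h
  set D : Fin (3 * m₁ * m₂ - 1) → ℝ := fun l => (xs (hiIdx l, c) - xs (loIdx l, c)) ^ 2 with hD
  have hD1 (l) (hl : l ∈ rowSet m₁ m₂) : D l = 0 := by
    have := Abar_eq_zero_of_stationary hε hLf hm hd hβ hst ⟨l, hl⟩ c
    unfold Abar at this
    rw [mulVecE_blockMatrix] at this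
    simp only [hD]
    rw [(mul_eq_zero.1 this).resolve_left hK.ne']
    simp
  have hD2 : (((3 * m₁ * m₂ : ℕ) : ℝ) * Lf) ^ 2 * ∑ l, D l ≤ ε ^ 2 := by
    have h1 := pow_le_pow_left₀ (norm_nonneg _) hA 2
    rw [EuclideanSpace.norm_sq_eq, Fintype.sum_prod_type_right] at h1
    have h2 := single_le_sum (f := fun c' => ∑ l, ‖mulVecE (A Lf m₁ m₂ d) xs (l, c')‖ ^ 2)
      (fun c' _ => sum_nonneg fun l _ => sq_nonneg _) (mem_univ c)
    refine le_trans (le_of_eq ?_) (h2.trans h1)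
    rw [← sum_compl_add_sum (rowSet m₁ m₂), sum_eq_zero hD1, add_zero, ← sum_coe_sort, mul_sum]
    refine sum_congr rfl fun l _ => ?_
    unfold A
    rw [mulVecE_blockMatrix, Real.norm_eq_abs, sq_abs, mul_pow _ (_ - _)]
  let v : ℕ → ℝ := fun n => if h : n < 3 * m₁ * m₂ then xs (⟨n, h⟩, c) else 0
  have hv (i : Fin (3 * m₁ * m₂)) : v i = xs (i, c) := by simp [v]
  have key := sq_sub_le_mul_sum_sq v (N := 3 * m₁ * m₂ - 1) (a := i) (b := i') (by omega) (by omega)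
  have hsum : ∑ l ∈ range (3 * m₁ * m₂ - 1), (v (l + 1) - v l) ^ 2 = ∑ l, D l := by
    rw [sum_range]
    refine sum_congr rfl fun l _ => ?_
    simp only [hD, ← hv]
    rfl
  rw [hv, hv, hsum] at key
  refine key.trans ?_
  have h1 : ∑ l, D l ≤ (ε / (((3 * m₁ * m₂ : ℕ) : ℝ) * Lf)) ^ 2 := by
    rw [div_pow, le_div_iff₀ (by positivity)]; linarith
  refine mul_le_mul ?_ h1 (sum_nonneg fun l _ => sq_nonneg _) hm'.le
  exact_mod_cast Nat.sub_le _ _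

theorem scaledSeq_close_of_stationary (hε : 0 < ε) (hLf : 0 < Lf) (hm : 0 < 3 * m₁ * m₂)
    (hd : Odd d) (hβ : (50 * Real.pi + 1) * Real.sqrt ((3 * m₁ * m₂ : ℕ) : ℝ) * ε < β)
    {xs : EuclideanSpace ℝ (Fin (3 * m₁ * m₂) × Fin d)}
    (hst : (hardInstance ε Lf β m₁ m₂ d).IsStationary ε xs) (i i' : Fin (3 * m₁ * m₂)) (c : ℕ) :
    |scaledSeq ε Lf xs i c - scaledSeq ε Lf xs i' c| ≤ 1 / (150 * Real.pi) := by
  have hpi := Real.pi_pos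
  have hm' : (0 : ℝ) < (3 * m₁ * m₂ : ℕ) := by exact_mod_cast hm
  by_cases hc : c < d
  · have h := blocks_close_of_stationary hε hLf hm hd hβ hst i i' ⟨c, hc⟩
    refine abs_le_of_sq_le_sq ?_ (by positivity)
    have e1 : scaledSeq ε Lf xs i c = scaleFactor ε Lf (3 * m₁ * m₂) * xs (i, ⟨c, hc⟩) := by
      rw [← blockSeq_coe]; rfl
    have e2 : scaledSeq ε Lf xs i' c = scaleFactor ε Lf (3 * m₁ * m₂) * xs (i', ⟨c, hc⟩) := by
      rw [← blockSeq_coe]; rfl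
    rw [e1, e2, ← mul_sub, mul_pow]
    refine (mul_le_mul_of_nonneg_left h (sq_nonneg _)).trans (le_of_eq ?_)
    unfold scaleFactor
    rw [div_pow, mul_pow (Real.sqrt _), Real.sq_sqrt hm'.le]
    field_simp
  · have h0 (i) : scaledSeq ε Lf xs i c = 0 := by simp [scaledSeq, blockSeq, coord, hc]
    rw [h0, h0, sub_zero, abs_zero]
    positivity

/-- For equal blocks, the incoming link (or the first term, if c = 0) contributes at most -6/5 on
average, and the outgoing link only helps since `pairFunU` is nonpositive. -/
theorem sum_chainGrad_le {z : ℕ → ℝ} {c : ℕ} (hc : c < d) (hz : |z c| ≤ 1)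
    (hz' : ∀ n < c, 1 ≤ |z n|) :
    ∑ i : Fin (3 * m₁ * m₂), chainGrad (weight (m₁ * m₂) d i) z c ≤
      -(6 / 5) * ((3 * m₁ * m₂ : ℕ) : ℝ) := by
  have hU (i c : ℕ) : weight (m₁ * m₂) d i c * pairFunU (z c) (z (c + 1)) ≤ 0 :=
    mul_nonpos_of_nonneg_of_nonpos (weight_nonneg _ _ _ _) (pairFunU_nonpos _ _)
  rcases c with _ | c
  · calc _ ≤ ∑ i : Fin (3 * m₁ * m₂), (-(6 / 5) : ℝ) := by
          refine sum_le_sum fun i _ => ?_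
          have h1 : 3 / 5 * 2 ≤ Psi 1 * dPhi (z 0) :=
            mul_le_mul (Psi_lower le_rfl) (dPhi_lower hz) (by norm_num) (Psi_nonneg _)
          have h2 := hU i 0
          simp only [chainGrad, zero_add] at *
          linarith
      _ = _ := by rw [sum_const, card_univ, Fintype.card_fin, nsmul_eq_mul, mul_comm]
  · calc _ ≤ ∑ i : Fin (3 * m₁ * m₂),
            weight (m₁ * m₂) d i c * pairFunV (z c) (z (c + 1)) := by
          refine sum_le_sum fun i _ => ?_
          have h2 := hU i (c + 1)
          simp only [chainGrad]
          linarith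
      _ = ((3 * m₁ * m₂ : ℕ) : ℝ) * pairFunV (z c) (z (c + 1)) := by
          rw [← sum_mul, ← sum_range fun i => weight (m₁ * m₂) d i c, mul_assoc 3 m₁ m₂,
            sum_weight hc]
          push_cast; rfl
      _ ≤ _ := by
          rw [mul_comm (-(6 / 5) : ℝ)]
          exact mul_le_mul_of_nonneg_left (pairFunV_le (hz' c (Nat.lt_succ_self c)) hz)
            (Nat.cast_nonneg _)

/-- Strong induction: all earlier coordinates have modulus at least 1, so a coordinate below 1 would
be the first such one and would receive a uniform push. The test direction shifts it in all blocks
at once. -/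
theorem one_le_abs_scaledSeq_of_stationary (hε : 0 < ε) (hLf : 0 < Lf) (hm : 0 < 3 * m₁ * m₂)
    (hd : Odd d) (hβ : (50 * Real.pi + 1) * Real.sqrt ((3 * m₁ * m₂ : ℕ) : ℝ) * ε < β)
    {xs : EuclideanSpace ℝ (Fin (3 * m₁ * m₂) × Fin d)}
    (hst : (hardInstance ε Lf β m₁ m₂ d).IsStationary ε xs) (i₀ : Fin (3 * m₁ * m₂)) {c : ℕ}
    (hc : c < d) : 1 ≤ |scaledSeq ε Lf xs i₀ c| := by
  induction c using Nat.strong_induction_on with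
  | _ c ih =>
    by_contra! hlt
    have hpi := Real.pi_gt_three
    have hm' : (0 : ℝ) < (3 * m₁ * m₂ : ℕ) := by exact_mod_cast hm
    have hs : 0 < Real.sqrt (3 * m₁ * m₂ : ℕ) := Real.sqrt_pos.2 hm'
    have hzero (S) : mulVecE (blockMatrix Lf m₁ m₂ d S)
        (stepVec (3 * m₁ * m₂) 0 ⟨c, hc⟩ 1) = 0 := by
      ext ⟨l, c'⟩
      rw [mulVecE_stepVec, if_neg (by omega)]
      rfl
    have h := stationary_test hε hLf hm hd hst (hzero _)
    rw [mulVecE_add, Abar, hzero, add_zero, sub_self, mul_zero, add_zero, inner_stepVec] at h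
    have hn := norm_stepVec_le (m := 3 * m₁ * m₂) 0 (⟨c, hc⟩ : Fin d) 1
    rw [abs_one, one_mul] at hn
    have hn' := mul_le_mul_of_nonneg_left hn (by positivity : 0 ≤ 6 / 5 * ε)
    have hG : ∑ i : Fin (3 * m₁ * m₂), chainGrad (weight (m₁ * m₂) d i) (scaledSeq ε Lf xs i) c ≤
        -(7 / 10) * ((3 * m₁ * m₂ : ℕ) : ℝ) := by
      have h1 := sum_chainGrad_le (m₁ := m₁) (m₂ := m₂) hc hlt.le fun n hn => ih n hn (hn.trans hc)
      -- Replacing block i by block i₀ moves each scaled entry by at most 1/(150π), which changes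
      -- the partial derivative by at most (76 + 48π)/(150π) ≤ 1/2.
      calc _ ≤ ∑ i : Fin (3 * m₁ * m₂),
            (chainGrad (weight (m₁ * m₂) d i) (scaledSeq ε Lf xs i₀) c + 1 / 2) := by
            refine sum_le_sum fun i _ => ?_
            have h2 := (le_abs_self _).trans (abs_chainGrad_sub_le (weight_nonneg (m₁ * m₂) d i)
              (weight_le (m₁ * m₂) d i) (scaledSeq ε Lf xs i) (scaledSeq ε Lf xs i₀) c)
            have hcl := scaledSeq_close_of_stationary hε hLf hm hd hβ hst i i₀
            have h3 : (if c = 0 then 0 else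
                |scaledSeq ε Lf xs i (c - 1) - scaledSeq ε Lf xs i₀ (c - 1)|) ≤
                1 / (150 * Real.pi) := by
              split_ifs
              · positivity
              · exact hcl _
            have h4 := mul_le_mul_of_nonneg_left (hcl c) (by positivity : 0 ≤ 28 + 48 * Real.pi)
            have h5 : 24 * (1 / (150 * Real.pi)) + (28 + 48 * Real.pi) * (1 / (150 * Real.pi)) +
                24 * (1 / (150 * Real.pi)) ≤ 1 / 2 := by
              rw [← add_mul, ← add_mul, mul_one_div, div_le_iff₀ (by positivity)]
              linarith
            linarith [hcl (c + 1)]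
        _ ≤ _ := by
            rw [sum_add_distrib, sum_const, card_univ, Fintype.card_fin, nsmul_eq_mul]
            linarith
    have hsum : ∑ i : Fin (3 * m₁ * m₂),
        (if 0 ≤ (i : ℕ) then 1 * f0Grad ε Lf xs (i, ⟨c, hc⟩) else 0) =
        2 * ε / Real.sqrt (3 * m₁ * m₂ : ℕ) * ∑ i : Fin (3 * m₁ * m₂),
          chainGrad (weight (m₁ * m₂) d i) (scaledSeq ε Lf xs i) c := by
      rw [mul_sum]
      exact sum_congr rfl fun i _ => by simp [f0Grad]
    rw [hsum] at h
    have h6 := mul_le_mul_of_nonneg_left hG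
      (by positivity : 0 ≤ 2 * ε / Real.sqrt (3 * m₁ * m₂ : ℕ))
    -- The derivative along the shift is at most -(7/5)ε√m, below the allowed -(6/5)ε√m.
    have h7 : 2 * ε / Real.sqrt (3 * m₁ * m₂ : ℕ) * (-(7 / 10) * ((3 * m₁ * m₂ : ℕ) : ℝ)) =
        -(7 / 5) * (ε * Real.sqrt (3 * m₁ * m₂ : ℕ)) := by
      field_simp
      rw [Real.sq_sqrt hm'.le]
      ring
    have := mul_pos hε hs
    linarith

/-- Each of the m blocks contributes at least the squared inverse scale factor to the squared
distance, and m such terms add up to (150πε/L_f)². -/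
theorem far_from_stationary (hε : 0 < ε) (hLf : 0 < Lf) (hm : 0 < 3 * m₁ * m₂)
    (hd : Odd d) (hβ : (50 * Real.pi + 1) * Real.sqrt ((3 * m₁ * m₂ : ℕ) : ℝ) * ε < β)
    {xs : EuclideanSpace ℝ (Fin (3 * m₁ * m₂) × Fin d)}
    (hst : (hardInstance ε Lf β m₁ m₂ d).IsStationary ε xs)
    {x : EuclideanSpace ℝ (Fin (3 * m₁ * m₂) × Fin d)} {c : Fin d} (hx : ∀ i, x (i, c) = 0) :
    150 * Real.pi * ε / Lf ≤ ‖x - xs‖ := by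
  have hpi := Real.pi_pos
  have hm' : (0 : ℝ) < (3 * m₁ * m₂ : ℕ) := by exact_mod_cast hm
  refine (sq_le_sq₀ (by positivity) (norm_nonneg _)).1 ?_
  have hs : 0 < scaleFactor ε Lf (3 * m₁ * m₂) := by unfold scaleFactor; positivity
  have hi (i : Fin (3 * m₁ * m₂)) : (1 / scaleFactor ε Lf (3 * m₁ * m₂)) ^ 2 ≤ xs (i, c) ^ 2 := by
    have h := one_le_abs_scaledSeq_of_stationary hε hLf hm hd hβ hst i c.2
    unfold scaledSeq at h
    rw [blockSeq_coe, abs_mul, abs_of_pos hs] at h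
    rw [← sq_abs (xs (i, c))]
    refine pow_le_pow_left₀ (by positivity) ?_ 2
    rw [div_le_iff₀ hs]; linarith
  rw [EuclideanSpace.norm_sq_eq, Fintype.sum_prod_type_right]
  have h2 := single_le_sum (f := fun c' => ∑ i, ‖(x - xs) (i, c')‖ ^ 2)
    (fun c' _ => sum_nonneg fun l _ => sq_nonneg _) (mem_univ c)
  refine le_trans ?_ h2
  calc _ = ∑ i : Fin (3 * m₁ * m₂), (1 / scaleFactor ε Lf (3 * m₁ * m₂)) ^ 2 := by
        rw [sum_const, card_univ, Fintype.card_fin, nsmul_eq_mul]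
        unfold scaleFactor
        rw [one_div_div, div_pow, div_pow, mul_pow (Real.sqrt _), Real.sq_sqrt hm'.le]
        field_simp
    _ ≤ _ := by
        refine sum_le_sum fun i _ => ?_
        rw [PiLp.sub_apply, hx, zero_sub, norm_neg, Real.norm_eq_abs, sq_abs]
        exact hi i

end

end HardInstance

/-! ### The complexity lower bound -/

theorem mainTheorem3 (ε Lf : ℝ) (hε : 0 < ε) (hLf : 0 < Lf)
    (m₁ m₂ dbar : ℕ) (hm₁ : 2 ≤ m₁) (hm₂ : 1 ≤ m₂) (hm : Even (m₁ * m₂))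
    (hd : 5 ≤ dbar) (hdodd : Odd dbar) (β : ℝ)
    (hβ : (50 * Real.pi + 1 + spectralNorm2 (HardInstance.A Lf m₁ m₂ dbar)) *
      Real.sqrt ((3 * m₁ * m₂ : ℕ) : ℝ) * ε < β) :
    (hardInstance ε Lf β m₁ m₂ dbar).StandingAssumption Lf ∧
    ∀ ω : ℝ, 0 ≤ ω → ω < 150 * Real.pi * ε / Lf →
      ∀ (x : ℕ → EuclideanSpace ℝ (Fin (3 * m₁ * m₂) × Fin dbar))
        (y : ℕ → EuclideanSpace ℝ (HardInstance.rowSet m₁ m₂ × Fin dbar)),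
        x 0 = 0 → y 0 = 0 →
        (hardInstance ε Lf β m₁ m₂ dbar).SplittingSpan x y →
        ∀ t : ℕ,
          (∃ xs, (hardInstance ε Lf β m₁ m₂ dbar).IsStationary ε xs ∧ ‖x t - xs‖ ≤ ω) →
          ⌈(hardInstance ε Lf β m₁ m₂ dbar).jointCond * Lf *
              (hardInstance ε Lf β m₁ m₂ dbar).gap (x 0) /
              (18000 * Real.pi ^ 2) * ε⁻¹ ^ 2⌉ ≤ (t : ℤ) := by
  have hpi := Real.pi_pos
  have hmpos : 0 < 3 * m₁ * m₂ := by positivity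
  have hβ' : (50 * Real.pi + 1) * Real.sqrt ((3 * m₁ * m₂ : ℕ) : ℝ) * ε < β := by
    refine lt_of_le_of_lt ?_ hβ
    have : 0 ≤ spectralNorm2 (HardInstance.A Lf m₁ m₂ dbar) := norm_nonneg _
    exact mul_le_mul_of_nonneg_right (mul_le_mul_of_nonneg_right (by linarith)
      (Real.sqrt_nonneg _)) hε.le
  have hβ0 : 0 ≤ β := le_trans (by positivity) hβ'.le
  refine ⟨HardInstance.standingAssumption_hardInstance hε hLf hβ0 hmpos hdodd, ?_⟩
  rintro ω - hω x y hx0 hy0 hxy t ⟨xs, hst, hclose⟩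
  have ht : (dbar - 2) * (m₁ * m₂) ≤ t := by
    by_contra! hlt
    have := HardInstance.far_from_stationary hε hLf hmpos hdodd hβ' hst
      (HardInstance.last_coord_eq_zero hε hLf hβ0 hmpos hdodd hd hx0 hy0 hxy hlt)
    linarith
  rw [Int.ceil_le, hx0, Int.cast_natCast]
  have ht' : ((dbar : ℝ) - 2) * (m₁ * m₂) ≤ t := by
    have h : ((dbar - 2 : ℕ) : ℝ) * (m₁ * m₂) ≤ t := by exact_mod_cast ht
    rwa [Nat.cast_sub (by omega), Nat.cast_ofNat] at h
  refine le_trans ?_ ht'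
  have hcond : (hardInstance ε Lf β m₁ m₂ dbar).jointCond ≤ 2 * ((3 * m₁ * m₂ : ℕ) : ℝ) :=
    HardInstance.jointCond_le hLf hmpos
  have hcond0 : 0 ≤ (hardInstance ε Lf β m₁ m₂ dbar).jointCond := Real.sqrt_nonneg _
  have hgap : (hardInstance ε Lf β m₁ m₂ dbar).gap 0 ≤ _ :=
    HardInstance.gap_le hε hLf hβ0 hmpos hdodd
  calc _ ≤ (hardInstance ε Lf β m₁ m₂ dbar).jointCond * Lf *
        (1800 * Real.pi ^ 2 * ε ^ 2 * dbar / Lf) / (18000 * Real.pi ^ 2) * ε⁻¹ ^ 2 := by gcongr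
    _ ≤ 2 * ((3 * m₁ * m₂ : ℕ) : ℝ) * Lf * (1800 * Real.pi ^ 2 * ε ^ 2 * dbar / Lf) /
        (18000 * Real.pi ^ 2) * ε⁻¹ ^ 2 := by gcongr
    _ = 3 / 5 * (dbar : ℝ) * (m₁ * m₂) := by
        push_cast
        field_simp
        norm_num
    -- (3/5)d̄ ≤ d̄ - 2 is equivalent to d̄ ≥ 5.
    _ ≤ _ := by
        have : (5 : ℝ) ≤ dbar := by exact_mod_cast hd
        gcongr
        linarith
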